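/- Let $0<\kappa<1$, $\lambda=\sqrt{1-\kappa^2}$, and let $k>0$ be given by $k^2=\frac{1-\lambda}{1+\lambda}$. Put $f(T)=\int_0^T {}_2F_1\left(\tfrac14,\tfrac34;\tfrac12;\kappa^2\sin^2 t\right)dt$ for complex $T$ near $0$, let $\phi$ be the analytic inverse of $f$ near $0$ with $\phi(0)=0$, and let $\psi$ be the function analytic near $0$ with $\psi(0)=0$ and $\sin\psi=\kappa\sin\phi$. Then there is exactly one elliptic function on $\mathbb{C}$ that agrees with $\cos\psi$ near $0$; call it $\mathrm{dn}_2$. Likewise there is exactly one meromorphic function on $\mathbb{C}$ that near $0$ agrees with $\sin\circ\mathrm{am}$, where $\mathrm{am}$ is the analytic inverse near $0$, with $\mathrm{am}(0)=0$, of $T\mapsto\int_0^T\frac{d\theta}{\sqrt{1-k^2\sin^2\theta}}$; it is the Jacobi sine $\mathrm{sn}=\mathrm{sn}(\cdot,k)$ of modulus $k$. As meromorphic functions of $z\in\mathbb{C}$, $$\mathrm{dn}_2(z)=1-(1-\lambda)\,\mathrm{sn}^2\!\left(z\sqrt{\tfrac{1+\lambda}{2}}\right);$$ that is, $z$ is a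 pole of $\mathrm{dn}_2$ if and only if $z\sqrt{(1+\lambda)/2}$ is a pole of $\mathrm{sn}$, and the identity holds at every $z$ that is not a pole. -/

import Mathlib

open Filter Topology

noncomputable section

/-- The integral `∫₀ᵀ g(t) dt` of `g` along the straight segment from `0` to `T` in `ℂ`. -/
def integralFromZero (g : ℂ → ℂ) (T : ℂ) : ℂ :=
  ∫ s in (0 : ℝ)..1, T * g ((s : ℂ) * T)

/-- `φ` is an analytic local inverse at `0` of the function `f` with `f 0 = 0`. -/
structure IsAnalyticLocalInverse (f φ : ℂ → ℂ) : Prop where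
  analyticAt : AnalyticAt ℂ φ 0
  map_zero : φ 0 = 0
  right_inv : ∀ᶠ z in 𝓝 (0 : ℂ), f (φ z) = z
  left_inv : ∀ᶠ T in 𝓝 (0 : ℂ), φ (f T) = T

/-- A meromorphic function on the whole plane, represented by a function `ℂ → ℂ` that is
continuous away from its poles and, by convention, takes the value `0` at each pole. -/
def IsMeromorphicOnPlane (f : ℂ → ℂ) : Prop :=
  MeromorphicNFOn f Set.univ

/-- An elliptic function: meromorphic on the plane, with two periods that are linearly
independent over `ℝ`. -/
def IsEllipticFunction (f : ℂ → ℂ) : Prop :=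
  IsMeromorphicOnPlane f ∧
    ∃ ω₁ ω₂ : ℂ, LinearIndependent ℝ ![ω₁, ω₂] ∧ f.Periodic ω₁ ∧ f.Periodic ω₂

/-- The meromorphic function `f` has a pole at `z`. -/
def HasPoleAt (f : ℂ → ℂ) (z : ℂ) : Prop :=
  MeromorphicAt f z ∧ meromorphicOrderAt f z < 0

/-- `f(T) = ∫₀ᵀ F(1/4, 3/4; 1/2; κ² sin² t) dt`, with `F` the Gauss hypergeometric function. -/
def shenIntegral (κ : ℝ) (T : ℂ) : ℂ :=
  integralFromZero (fun t =>
    ordinaryHypergeometric (1 / 4 : ℂ) (3 / 4 : ℂ) (1 / 2 : ℂ)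
      ((κ : ℂ) ^ 2 * Complex.sin t ^ 2)) T

/-- `d` is Shen's function `dn₂` of modulus `κ`: the elliptic function that near `0` is `cos ψ`,
where `sin ψ = κ sin φ`, `ψ(0) = 0`, and `φ` is the local inverse of `shenIntegral κ`. -/
def IsShenDn2 (κ : ℝ) (d : ℂ → ℂ) : Prop :=
  IsEllipticFunction d ∧
    ∃ φ ψ : ℂ → ℂ, IsAnalyticLocalInverse (shenIntegral κ) φ ∧
      AnalyticAt ℂ ψ 0 ∧ ψ 0 = 0 ∧
      (∀ᶠ z in 𝓝 (0 : ℂ), Complex.sin (ψ z) = (κ : ℂ) * Complex.sin (φ z)) ∧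
      (∀ᶠ z in 𝓝 (0 : ℂ), d z = Complex.cos (ψ z))

/-- Shen's elliptic function `dn₂` of modulus `κ`. -/
def shenDn2 (κ : ℝ) : ℂ → ℂ :=
  Classical.epsilon (IsShenDn2 κ)

/-- The incomplete elliptic integral of the first kind `∫₀ᵀ dθ / √(1 - k² sin² θ)`
(principal square root; it is used only for `T` near `0`). -/
def incompleteEllipticIntegral (k : ℝ) (T : ℂ) : ℂ :=
  integralFromZero (fun θ =>
    ((1 - (k : ℂ) ^ 2 * Complex.sin θ ^ 2) ^ (1 / 2 : ℂ))⁻¹) T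

/-- `s` is the Jacobi sine of modulus `k`: the meromorphic function on the plane that near `0` is
the sine of the amplitude, the local inverse of the elliptic integral of the first kind. -/
def IsJacobiSn (k : ℝ) (s : ℂ → ℂ) : Prop :=
  IsMeromorphicOnPlane s ∧
    ∃ am : ℂ → ℂ, IsAnalyticLocalInverse (incompleteEllipticIntegral k) am ∧
      ∀ᶠ z in 𝓝 (0 : ℂ), s z = Complex.sin (am z)

/-- The Jacobi sine function `sn(•, k)` of modulus `k`. -/
def jacobiSn (k : ℝ) : ℂ → ℂ :=
  Classical.epsilon (IsJacobiSn k)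

end

/-! The local identity is a change of variable. Averaging the binomial series of `(1 - x)^(-1/2)`
over `±x` gives `F(1/4, 3/4; 1/2; x²)`, so `F(sin² w) = cos (w/2) / cos w` near `0`. As `κ² sin² φ =
sin² ψ`, inverting the integral yields `φ' = cos ψ / cos (ψ/2)`, hence `ψ' = κ cos φ / cos (ψ/2)`.
With `μ = √((1 + λ)/2)` and `a = 2μ/κ`, the function `S(z) = a sin (ψ(z/μ)/2)` satisfies `S' = cos
φ(z/μ)` and `S'² = (1 - S²)(1 - k²S²)`, with `S(0) = 0` and `S'(0) = 1`. So `S` is the germ of `sn`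
(`IsAnalyticLocalInverse.isJacobiTriple_shen`), and `cos ψ = 1 - 2 sin² (ψ/2)` becomes `1 - (1 - λ)
sn²(μz)`.

The global part treats `sn`, `cn`, `dn` as the solution of a polynomial differential system. Local
uniqueness of solutions proves each functional equation near `0`. The duplication formulas double
the disc of meromorphy again and again, so the germs extend to the plane
(`IsJacobiTriple.exists_isJacobiFunctions`), and the identity theorem carries the equations along.

Ellipticity of `dn₂` needs two periods of `sn²`. A positive zero `K` of `cn` makes `2K` an
antiperiod of `sn`; the same fact for the complementary parameter, moved by Jacobi's imaginary
transformation, gives a purely imaginary period. Poles match because `1 - λ ≠ 0` and squaring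
doubles orders. -/

/-! ### Identity theorem and continuation for meromorphic functions. -/

theorem MeromorphicOn.eventuallyEq_nhdsNE_of_isPreconnected {f g : ℂ → ℂ} {U : Set ℂ}
    (hf : MeromorphicOn f U) (hg : MeromorphicOn g U) (hU : IsPreconnected U) {x y : ℂ}
    (hx : x ∈ U) (hy : y ∈ U) (h : f =ᶠ[𝓝[≠] x] g) : f =ᶠ[𝓝[≠] y] g := by
  have hx' : meromorphicOrderAt (f - g) x = ⊤ := by
    rw [meromorphicOrderAt_eq_top_iff]
    filter_upwards [h] with z hz
    simp [hz]
  have hy' : meromorphicOrderAt (f - g) y = ⊤ := by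
    by_contra hne
    exact (hf.sub hg).meromorphicOrderAt_ne_top_of_isPreconnected hU hy hx hne hx'
  rw [meromorphicOrderAt_eq_top_iff] at hy'
  filter_upwards [hy'] with z hz
  exact sub_eq_zero.mp hz

/-- A normal form is determined at the centre by its punctured germ, so the identity theorem loses
its puncture, even at poles. -/
theorem MeromorphicNFOn.eventuallyEq_nhds_of_isPreconnected {f g : ℂ → ℂ} {U : Set ℂ}
    (hf : MeromorphicNFOn f U) (hg : MeromorphicNFOn g U) (hU : IsPreconnected U) {x y : ℂ}
    (hx : x ∈ U) (hy : y ∈ U) (h : f =ᶠ[𝓝[≠] x] g) : f =ᶠ[𝓝 y] g :=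
  ((hf hy).eventuallyEq_nhdsNE_iff_eventuallyEq_nhds (hg hy)).1
    (hf.meromorphicOn.eventuallyEq_nhdsNE_of_isPreconnected hg.meromorphicOn hU hx hy h)

theorem MeromorphicNFOn.eq_of_eventuallyEq {f g : ℂ → ℂ}
    (hf : MeromorphicNFOn f Set.univ) (hg : MeromorphicNFOn g Set.univ) {x : ℂ}
    (h : f =ᶠ[𝓝[≠] x] g) : f = g :=
  funext fun y => (hf.eventuallyEq_nhds_of_isPreconnected hg isPreconnected_univ
    (Set.mem_univ x) (Set.mem_univ y) h).eq_of_nhds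

/-- A germ at `0` that continues meromorphically to arbitrarily large discs continues
meromorphically to the plane. -/
theorem exists_meromorphicNFOn_univ_of_forall_ball {f : ℂ → ℂ} (hf : AnalyticAt ℂ f 0) {r : ℝ}
    (hr : 0 < r)
    (h : ∀ n : ℕ, ∃ g, MeromorphicOn g (Metric.ball 0 (2 ^ n * r)) ∧ g =ᶠ[𝓝 0] f) :
    ∃ G, MeromorphicNFOn G Set.univ ∧ G =ᶠ[𝓝 0] f := by
  choose g hg hgf using h
  set B : ℕ → Set ℂ := fun n => Metric.ball 0 (2 ^ n * r) with hB
  have h0 (n : ℕ) : (0 : ℂ) ∈ B n := Metric.mem_ball_self (by positivity)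
  have hmono {m n : ℕ} (hmn : m ≤ n) : B m ⊆ B n :=
    Metric.ball_subset_ball (by gcongr; norm_num)
  have hcover (z : ℂ) : ∃ n, z ∈ B n := by
    obtain ⟨n, hn⟩ := pow_unbounded_of_one_lt (‖z‖ / r) (one_lt_two : (1 : ℝ) < 2)
    exact ⟨n, by simpa [hB] using (div_lt_iff₀ hr).1 hn⟩
  -- Normal forms make the continuations agree pointwise on overlaps, poles included, so they glue
  -- with any choice of `N z`.
  set H : ℕ → ℂ → ℂ := fun n => toMeromorphicNFOn (g n) (B n) with hH
  have hHnf (n : ℕ) : MeromorphicNFOn (H n) (B n) := meromorphicNFOn_toMeromorphicNFOn _ _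
  have hHf (n : ℕ) : H n =ᶠ[𝓝[≠] 0] f :=
    ((hg n).toMeromorphicNFOn_eq_self_on_nhdsNE (h0 n)).trans
      ((hgf n).filter_mono nhdsWithin_le_nhds)
  have hle {m n : ℕ} (hmn : m ≤ n) {z : ℂ} (hz : z ∈ B m) : H m z = H n z :=
    ((hHnf m).eventuallyEq_nhds_of_isPreconnected
      (fun w hw => hHnf n (hmono hmn hw)) (convex_ball _ _).isPreconnected (h0 m) hz
      ((hHf m).trans (hHf n).symm)).eq_of_nhds
  have hHH (m n : ℕ) {z : ℂ} (hm : z ∈ B m) (hn : z ∈ B n) : H m z = H n z := by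
    rcases le_total m n with hmn | hmn
    · exact hle hmn hm
    · exact (hle hmn hn).symm
  choose N hN using hcover
  have hG (z : ℂ) : (fun w => H (N w) w) =ᶠ[𝓝 z] H (N z) := by
    filter_upwards [Metric.isOpen_ball.mem_nhds (hN z)] with w hw
    exact hHH _ _ (hN w) hw
  refine ⟨fun z => H (N z) z, fun z _ => (meromorphicNFAt_congr (hG z)).2 (hHnf _ (hN z)),
    (hG 0).trans ?_⟩
  exact ((hHnf _ (h0 _)).eventuallyEq_nhdsNE_iff_eventuallyEq_nhds hf.meromorphicNFAt).1 (hHf _)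

/-! ### Uniqueness for holomorphic differential equations. -/

section ODE
variable {E : Type*} [NormedAddCommGroup E] [NormedSpace ℂ E] [CompleteSpace E]

/-- If `h` had a zero of finite order `n + 1`, its derivative would vanish only to order `n`, too
slowly for the bound. -/
theorem AnalyticAt.eventually_eq_zero_of_norm_deriv_le {h : ℂ → E} {z₀ : ℂ}
    (hh : AnalyticAt ℂ h z₀) (h0 : h z₀ = 0) {K : ℝ}
    (hK : ∀ᶠ z in 𝓝 z₀, ‖deriv h z‖ ≤ K * ‖h z‖) : ∀ᶠ z in 𝓝 z₀, h z = 0 := by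
  by_contra hne
  obtain ⟨n, g, hg, hg0, hhg⟩ := hh.exists_eventuallyEq_pow_smul_nonzero_iff.2 hne
  obtain _ | n := n
  · have := hhg.self_of_nhds
    simp only [pow_zero, one_smul] at this
    exact hg0 (this ▸ h0)
  have hd : ∀ᶠ z in 𝓝 z₀, deriv h z =
      (z - z₀) ^ n • (((n : ℂ) + 1) • g z + (z - z₀) • deriv g z) := by
    filter_upwards [hhg.eventually_nhds, hg.eventually_analyticAt] with z hz hgz
    have h1 : HasDerivAt (fun w : ℂ => (w - z₀) ^ (n + 1)) (((n : ℂ) + 1) * (z - z₀) ^ n) z := by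
      simpa using ((hasDerivAt_id z).sub_const z₀).fun_pow (n + 1)
    have h2 := h1.fun_smul hgz.differentiableAt.hasDerivAt
    rw [EventuallyEq.deriv_eq hz, h2.deriv]
    module
  have hle : ∀ᶠ z in 𝓝[≠] z₀,
      ‖((n : ℂ) + 1) • g z + (z - z₀) • deriv g z‖ ≤ K * (‖z - z₀‖ * ‖g z‖) := by
    filter_upwards [hd.filter_mono nhdsWithin_le_nhds, hhg.filter_mono nhdsWithin_le_nhds,
      hK.filter_mono nhdsWithin_le_nhds, self_mem_nhdsWithin] with z h1 h2 h3 h4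
    have hpos : 0 < ‖z - z₀‖ ^ n := by
      have : 0 < ‖z - z₀‖ := norm_pos_iff.2 (sub_ne_zero.2 h4)
      positivity
    rw [h1, h2, norm_smul, norm_smul, norm_pow, norm_pow] at h3
    refine le_of_mul_le_mul_left (h3.trans_eq ?_) hpos
    ring
  have hgc := hg.continuousAt
  have hgc' := hg.deriv.continuousAt
  have hl : Tendsto (fun z => ‖((n : ℂ) + 1) • g z + (z - z₀) • deriv g z‖) (𝓝[≠] z₀)
      (𝓝 ‖((n : ℂ) + 1) • g z₀ + (z₀ - z₀) • deriv g z₀‖) :=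
    tendsto_nhdsWithin_of_tendsto_nhds (ContinuousAt.tendsto (by fun_prop))
  have hr : Tendsto (fun z => K * (‖z - z₀‖ * ‖g z‖)) (𝓝[≠] z₀)
      (𝓝 (K * (‖z₀ - z₀‖ * ‖g z₀‖))) :=
    tendsto_nhdsWithin_of_tendsto_nhds (ContinuousAt.tendsto (by fun_prop))
  have := le_of_tendsto_of_tendsto hl hr hle
  simp only [sub_self, zero_smul, add_zero, norm_zero, zero_mul, mul_zero] at this
  have h0' := norm_le_zero_iff.1 this
  rcases smul_eq_zero.1 h0' with h | h
  · exact Nat.cast_add_one_ne_zero n h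
  · exact hg0 h

/-- Local uniqueness for holomorphic autonomous differential equations. -/
theorem eventuallyEq_of_hasDerivAt_of_contDiffAt {v : E → E} {f g : ℂ → E} {z₀ : ℂ}
    (hv : ContDiffAt ℂ 1 v (f z₀)) (hf : ∀ᶠ z in 𝓝 z₀, HasDerivAt f (v (f z)) z)
    (hg : ∀ᶠ z in 𝓝 z₀, HasDerivAt g (v (g z)) z) (h0 : f z₀ = g z₀) : f =ᶠ[𝓝 z₀] g := by
  obtain ⟨K, t, ht, hK⟩ := hv.exists_lipschitzOnWith
  have hfa : AnalyticAt ℂ f z₀ := Complex.analyticAt_iff_eventually_differentiableAt.2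
    (hf.mono fun z hz => hz.differentiableAt)
  have hga : AnalyticAt ℂ g z₀ := Complex.analyticAt_iff_eventually_differentiableAt.2
    (hg.mono fun z hz => hz.differentiableAt)
  have key : ∀ᶠ z in 𝓝 z₀, f z - g z = 0 := by
    refine (hfa.sub hga).eventually_eq_zero_of_norm_deriv_le (K := K) (by simp [h0]) ?_
    filter_upwards [hf, hg, hfa.continuousAt.preimage_mem_nhds ht,
      hga.continuousAt.preimage_mem_nhds (h0 ▸ ht)] with z h1 h2 h3 h4
    rw [(h1.sub h2).deriv]
    exact hK.norm_sub_le h3 h4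
  exact key.mono fun z hz => sub_eq_zero.1 hz

end ODE

theorem eventually_eq_of_eventually_hasDerivAt_zero {f : ℂ → ℂ} {z₀ : ℂ}
    (h : ∀ᶠ z in 𝓝 z₀, HasDerivAt f 0 z) : ∀ᶠ z in 𝓝 z₀, f z = f z₀ :=
  eventuallyEq_of_hasDerivAt_of_contDiffAt (v := fun _ => 0) (g := fun _ => f z₀)
    contDiffAt_const h (.of_forall fun z => hasDerivAt_const z _) rfl

/-! ### Integrals from zero and their local inverses. -/

theorem eventually_hasDerivAt_integralFromZero {g : ℂ → ℂ} (hg : AnalyticAt ℂ g 0) :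
    ∀ᶠ T in 𝓝 (0 : ℂ), HasDerivAt (integralFromZero g) (g T) T := by
  obtain ⟨r, hr, hgr⟩ := Metric.eventually_nhds_iff_ball.1 hg.eventually_analyticAt
  obtain ⟨G, hG⟩ := DifferentiableOn.isExactOn_ball
    (f := g) (c := 0) (r := r) fun z hz => (hgr z hz).differentiableAt.differentiableWithinAt
  have hball : ∀ T ∈ Metric.ball (0 : ℂ) r, integralFromZero g T = G T - G 0 := by
    intro T hT
    have hmem : ∀ s ∈ Set.uIcc (0 : ℝ) 1, (s : ℂ) * T ∈ Metric.ball (0 : ℂ) r := by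
      intro s hs
      rw [Set.uIcc_of_le zero_le_one] at hs
      simp only [mem_ball_zero_iff, norm_mul, Complex.norm_real, Real.norm_eq_abs,
        abs_of_nonneg hs.1] at hT ⊢
      nlinarith [hs.2, norm_nonneg T]
    have h1 : ∀ s ∈ Set.uIcc (0 : ℝ) 1,
        HasDerivAt (fun s : ℝ => G ((s : ℂ) * T)) (T * g ((s : ℂ) * T)) s := by
      intro s hs
      have h2 : HasDerivAt (fun s : ℝ => (s : ℂ) * T) T s := by
        simpa using (Complex.ofRealCLM.hasDerivAt (x := s)).mul_const T
      have h3 := (hG _ (hmem s hs)).comp s h2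
      rw [mul_comm] at h3
      exact h3
    have hcont : ContinuousOn (fun s : ℝ => T * g ((s : ℂ) * T)) (Set.uIcc 0 1) := by
      intro s hs
      have := (hgr _ (hmem s hs)).continuousAt
      have h3 : ContinuousAt (fun s : ℝ => (s : ℂ) * T) s := by fun_prop
      exact (continuousAt_const.mul
        (ContinuousAt.comp (f := fun s : ℝ => (s : ℂ) * T) this h3)).continuousWithinAt
    simpa [integralFromZero] using
      intervalIntegral.integral_eq_sub_of_hasDerivAt h1 hcont.intervalIntegrable
  filter_upwards [Metric.ball_mem_nhds (0 : ℂ) hr] with T hT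
  have : integralFromZero g =ᶠ[𝓝 T] fun T => G T - G 0 := by
    filter_upwards [Metric.isOpen_ball.mem_nhds hT] with z hz using hball z hz
  exact ((hG T hT).sub_const _).congr_of_eventuallyEq this

theorem integralFromZero_zero (g : ℂ → ℂ) : integralFromZero g 0 = 0 := by
  simp [integralFromZero]

theorem analyticAt_integralFromZero {g : ℂ → ℂ} (hg : AnalyticAt ℂ g 0) :
    AnalyticAt ℂ (integralFromZero g) 0 :=
  Complex.analyticAt_iff_eventually_differentiableAt.2
    ((eventually_hasDerivAt_integralFromZero hg).mono fun _ h => h.differentiableAt)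

theorem exists_isAnalyticLocalInverse {f : ℂ → ℂ} (hf : AnalyticAt ℂ f 0) (h0 : f 0 = 0)
    (hf' : deriv f 0 ≠ 0) : ∃ φ, IsAnalyticLocalInverse f φ := by
  refine ⟨hf.hasStrictDerivAt.localInverse _ _ _ hf', ?_, ?_, ?_, ?_⟩
  · simpa [h0] using hf.analyticAt_localInverse hf'
  · simpa [h0] using HasStrictFDerivAt.localInverse_apply_image
      (hf.hasStrictDerivAt.hasStrictFDerivAt_equiv hf')
  · simpa [h0] using hf.hasStrictDerivAt.eventually_right_inverse hf'
  · exact hf.hasStrictDerivAt.eventually_left_inverse hf'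

theorem IsAnalyticLocalInverse.tendsto {f φ : ℂ → ℂ} (h : IsAnalyticLocalInverse f φ) :
    Tendsto φ (𝓝 0) (𝓝 0) := by
  simpa [h.map_zero] using h.analyticAt.continuousAt.tendsto

theorem IsAnalyticLocalInverse.eventuallyEq {f φ χ : ℂ → ℂ} (h : IsAnalyticLocalInverse f φ)
    (h' : IsAnalyticLocalInverse f χ) : φ =ᶠ[𝓝 0] χ := by
  filter_upwards [h'.tendsto.eventually h.left_inv, h'.right_inv] with z h1 h2
  rw [← h1, h2]

theorem IsAnalyticLocalInverse.eventually_hasDerivAt {f f' φ : ℂ → ℂ}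
    (h : IsAnalyticLocalInverse f φ) (hf : ∀ᶠ T in 𝓝 (0 : ℂ), HasDerivAt f (f' T) T) :
    ∀ᶠ z in 𝓝 (0 : ℂ), f' (φ z) ≠ 0 ∧ HasDerivAt φ (f' (φ z))⁻¹ z := by
  filter_upwards [h.tendsto.eventually hf, h.right_inv.eventually_nhds,
    h.analyticAt.eventually_analyticAt] with z h1 h2 h3
  have h4 := h3.differentiableAt.hasDerivAt
  have h5 : HasDerivAt (fun z => f (φ z)) 1 z := (hasDerivAt_id z).congr_of_eventuallyEq h2
  have h6 : f' (φ z) * deriv φ z = 1 := (h1.comp z h4).unique h5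
  refine ⟨left_ne_zero_of_mul_eq_one h6, ?_⟩
  rwa [← eq_inv_of_mul_eq_one_right h6]

/-! ### The Jacobi differential system and duplication. -/

/-- The differential system `s' = cd`, `c' = -sd`, `d' = -msc` near `z₀`. -/
def IsJacobiSystemAt (m : ℂ) (s c d : ℂ → ℂ) (z₀ : ℂ) : Prop :=
  ∀ᶠ z in 𝓝 z₀, HasDerivAt s (c z * d z) z ∧ HasDerivAt c (-(s z * d z)) z ∧
    HasDerivAt d (-(m * (s z * c z))) z

/-- `s`, `c`, `d` are near `0` the Jacobi functions `sn`, `cn`, `dn` of parameter `m = k²`. -/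
structure IsJacobiTriple (m : ℂ) (s c d : ℂ → ℂ) : Prop where
  sn_zero : s 0 = 0
  cn_zero : c 0 = 1
  dn_zero : d 0 = 1
  system : IsJacobiSystemAt m s c d 0

theorem IsJacobiSystemAt.eventuallyEq {m : ℂ} {s c d s' c' d' : ℂ → ℂ} {z₀ : ℂ}
    (h : IsJacobiSystemAt m s c d z₀) (h' : IsJacobiSystemAt m s' c' d' z₀)
    (hs : s z₀ = s' z₀) (hc : c z₀ = c' z₀) (hd : d z₀ = d' z₀) :
    s =ᶠ[𝓝 z₀] s' ∧ c =ᶠ[𝓝 z₀] c' ∧ d =ᶠ[𝓝 z₀] d' := by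
  have key : (fun z => (s z, c z, d z)) =ᶠ[𝓝 z₀] fun z => (s' z, c' z, d' z) := by
    refine eventuallyEq_of_hasDerivAt_of_contDiffAt
      (v := fun p : ℂ × ℂ × ℂ => (p.2.1 * p.2.2, -(p.1 * p.2.2), -(m * (p.1 * p.2.1))))
      (ContDiff.contDiffAt (by fun_prop)) ?_ ?_ (by simp [hs, hc, hd])
    · exact h.mono fun z hz => hz.1.prodMk (hz.2.1.prodMk hz.2.2)
    · exact h'.mono fun z hz => hz.1.prodMk (hz.2.1.prodMk hz.2.2)
  refine ⟨key.mono fun z hz => ?_, key.mono fun z hz => ?_, key.mono fun z hz => ?_⟩ <;>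
    simp_all

theorem IsJacobiSystemAt.congr {m : ℂ} {s c d s' c' d' : ℂ → ℂ} {z₀ : ℂ}
    (h : IsJacobiSystemAt m s c d z₀) (hs : s' =ᶠ[𝓝 z₀] s) (hc : c' =ᶠ[𝓝 z₀] c)
    (hd : d' =ᶠ[𝓝 z₀] d) : IsJacobiSystemAt m s' c' d' z₀ := by
  filter_upwards [h, hs.eventually_nhds, hc.eventually_nhds, hd.eventually_nhds]
    with z hz h1 h2 h3
  rw [EventuallyEq.eq_of_nhds h1, EventuallyEq.eq_of_nhds h2, EventuallyEq.eq_of_nhds h3]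
  exact ⟨hz.1.congr_of_eventuallyEq h1, hz.2.1.congr_of_eventuallyEq h2,
    hz.2.2.congr_of_eventuallyEq h3⟩

theorem IsJacobiSystemAt.analyticAt {m : ℂ} {s c d : ℂ → ℂ} {z₀ : ℂ}
    (h : IsJacobiSystemAt m s c d z₀) :
    AnalyticAt ℂ s z₀ ∧ AnalyticAt ℂ c z₀ ∧ AnalyticAt ℂ d z₀ := by
  simp only [Complex.analyticAt_iff_eventually_differentiableAt]
  exact ⟨h.mono fun z hz => hz.1.differentiableAt, h.mono fun z hz => hz.2.1.differentiableAt,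
    h.mono fun z hz => hz.2.2.differentiableAt⟩

namespace IsJacobiTriple

variable {m : ℂ} {s c d s' c' d' : ℂ → ℂ}

theorem eventuallyEq (h : IsJacobiTriple m s c d) (h' : IsJacobiTriple m s' c' d') :
    s =ᶠ[𝓝 0] s' ∧ c =ᶠ[𝓝 0] c' ∧ d =ᶠ[𝓝 0] d' :=
  h.system.eventuallyEq h'.system (h.sn_zero.trans h'.sn_zero.symm)
    (h.cn_zero.trans h'.cn_zero.symm) (h.dn_zero.trans h'.dn_zero.symm)

theorem congr (h : IsJacobiTriple m s c d) (hs : s' =ᶠ[𝓝 0] s) (hc : c' =ᶠ[𝓝 0] c)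
    (hd : d' =ᶠ[𝓝 0] d) : IsJacobiTriple m s' c' d' :=
  ⟨hs.eq_of_nhds.trans h.sn_zero, hc.eq_of_nhds.trans h.cn_zero, hd.eq_of_nhds.trans h.dn_zero,
    h.system.congr hs hc hd⟩

/-- The left side is a first integral of the system, fixed by its value at `0`. -/
theorem eventually_sq_add_sq (h : IsJacobiTriple m s c d) :
    ∀ᶠ z in 𝓝 0, s z ^ 2 + c z ^ 2 = 1 := by
  have h1 := eventually_eq_of_eventually_hasDerivAt_zero (f := fun z => s z ^ 2 + c z ^ 2)
    (z₀ := 0) (h.system.mono fun z ⟨hs, hc, _⟩ => by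
      refine ((hs.fun_pow 2).fun_add (hc.fun_pow 2)).congr_deriv ?_
      push_cast
      ring)
  simpa [h.sn_zero, h.cn_zero] using h1

theorem eventually_sq_add_mul_sq (h : IsJacobiTriple m s c d) :
    ∀ᶠ z in 𝓝 0, d z ^ 2 + m * s z ^ 2 = 1 := by
  have h1 := eventually_eq_of_eventually_hasDerivAt_zero (f := fun z => d z ^ 2 + m * s z ^ 2)
    (z₀ := 0) (h.system.mono fun z ⟨hs, _, hd⟩ => by
      refine ((hd.fun_pow 2).fun_add ((hs.fun_pow 2).const_mul m)).congr_deriv ?_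
      push_cast
      ring)
  simpa [h.sn_zero, h.dn_zero] using h1

/-- The duplication formulas. -/
theorem duplication (h : IsJacobiTriple m s c d) :
    IsJacobiTriple m
      (fun z => 2 * s (z / 2) * c (z / 2) * d (z / 2) / (1 - m * s (z / 2) ^ 4))
      (fun z => (c (z / 2) ^ 2 - s (z / 2) ^ 2 * d (z / 2) ^ 2) / (1 - m * s (z / 2) ^ 4))
      (fun z => (d (z / 2) ^ 2 - m * s (z / 2) ^ 2 * c (z / 2) ^ 2) /
        (1 - m * s (z / 2) ^ 4)) := by
  refine ⟨by simp [h.sn_zero], by simp [h.sn_zero, h.cn_zero], by simp [h.sn_zero, h.dn_zero], ?_⟩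
  have hN : ∀ᶠ z in 𝓝 (0 : ℂ), 1 - m * s z ^ 4 ≠ 0 := by
    have h1 := h.system.analyticAt.1.continuousAt
    have h2 : ContinuousAt (fun z => 1 - m * s z ^ 4) 0 := by fun_prop
    exact h2.eventually_ne (by simp [h.sn_zero])
  have hhalf : Tendsto (fun z : ℂ => z / 2) (𝓝 0) (𝓝 0) := by
    have : ContinuousAt (fun z : ℂ => z / 2) 0 := by fun_prop
    simpa using this.tendsto
  filter_upwards [hhalf.eventually h.system, hhalf.eventually hN,
    hhalf.eventually h.eventually_sq_add_sq, hhalf.eventually h.eventually_sq_add_mul_sq]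
    with z ⟨h1, h2, h3⟩ hN hsc hsd
  have hh : HasDerivAt (fun z : ℂ => z / 2) (1 / 2) z := (hasDerivAt_id z).div_const 2
  have hs : HasDerivAt (fun z => s (z / 2)) (c (z / 2) * d (z / 2) * (1 / 2)) z := h1.comp z hh
  have hc : HasDerivAt (fun z => c (z / 2)) (-(s (z / 2) * d (z / 2)) * (1 / 2)) z :=
    h2.comp z hh
  have hd : HasDerivAt (fun z => d (z / 2)) (-(m * (s (z / 2) * c (z / 2))) * (1 / 2)) z :=
    h3.comp z hh
  have hden := ((hs.fun_pow 4).const_mul m).const_sub 1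
  have hS := (((hs.const_mul 2).fun_mul hc).fun_mul hd).fun_div hden hN
  have hC := ((hc.fun_pow 2).fun_sub ((hs.fun_pow 2).fun_mul (hd.fun_pow 2))).fun_div hden hN
  have hD := ((hd.fun_pow 2).fun_sub (((hs.fun_pow 2).const_mul m).fun_mul
    (hc.fun_pow 2))).fun_div hden hN
  -- After clearing denominators only polynomial identities in `x`, `y`, `w` remain, modulo the two
  -- quadratic relations `hsc` and `hsd`.
  generalize s (z / 2) = x at *
  generalize c (z / 2) = y at *
  generalize d (z / 2) = w at *
  refine ⟨?_, ?_, ?_⟩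
  · refine hS.congr_deriv ?_
    field_simp
    push_cast
    grind
  · refine hC.congr_deriv ?_
    field_simp
    push_cast
    grind
  · refine hD.congr_deriv ?_
    field_simp
    push_cast
    grind

end IsJacobiTriple

/-! ### Continuation of the Jacobi functions to the plane. -/

theorem MeromorphicAt.duplication {u v w : ℂ → ℂ} {z : ℂ} (m : ℂ) (hu : MeromorphicAt u z)
    (hv : MeromorphicAt v z) (hw : MeromorphicAt w z) :
    MeromorphicAt (fun z => 2 * u z * v z * w z / (1 - m * u z ^ 4)) z ∧
    MeromorphicAt (fun z => (v z ^ 2 - u z ^ 2 * w z ^ 2) / (1 - m * u z ^ 4)) z ∧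
    MeromorphicAt (fun z => (w z ^ 2 - m * u z ^ 2 * v z ^ 2) / (1 - m * u z ^ 4)) z := by
  refine ⟨?_, ?_, ?_⟩ <;> fun_prop

theorem MeromorphicNFAt.neg {f : ℂ → ℂ} {z : ℂ} (hf : MeromorphicNFAt f z) :
    MeromorphicNFAt (fun w => -f w) z := by
  have := (meromorphicNFAt_mul_iff_right (f := f) (g := fun _ => (-1 : ℂ)) (x := z)
    analyticAt_const (by simp)).2 hf
  simpa [Pi.mul_def] using this

/-- Sums, products and derivatives of normal forms need not be in normal form; here normality is
asked only at the target point. -/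
theorem MeromorphicOn.eventuallyEq_nhds_of_meromorphicNFAt {f g : ℂ → ℂ}
    (hf : MeromorphicOn f Set.univ) (hg : MeromorphicOn g Set.univ) {x y : ℂ}
    (h : f =ᶠ[𝓝[≠] x] g) (hfy : MeromorphicNFAt f y) (hgy : MeromorphicNFAt g y) :
    f =ᶠ[𝓝 y] g :=
  (hfy.eventuallyEq_nhdsNE_iff_eventuallyEq_nhds hgy).1
    (hf.eventuallyEq_nhdsNE_of_isPreconnected hg isPreconnected_univ
      (Set.mem_univ x) (Set.mem_univ y) h)

/-- Meromorphic functions on the plane that are the Jacobi functions of parameter `m`. -/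
structure IsJacobiFunctions (m : ℂ) (s c d : ℂ → ℂ) : Prop extends IsJacobiTriple m s c d where
  sn_mero : MeromorphicNFOn s Set.univ
  cn_mero : MeromorphicNFOn c Set.univ
  dn_mero : MeromorphicNFOn d Set.univ

/-- Duplication expresses the values at `z` through those at `z / 2`, so a triple meromorphic on a
disc yields one on the disc of twice the radius; uniqueness identifies the germs at `0`. -/
theorem IsJacobiTriple.exists_isJacobiFunctions {m : ℂ} {s c d : ℂ → ℂ}
    (h : IsJacobiTriple m s c d) : ∃ s' c' d', IsJacobiFunctions m s' c' d' := by
  obtain ⟨hsa, hca, hda⟩ := h.system.analyticAt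
  obtain ⟨r, hr, hball⟩ := Metric.eventually_nhds_iff_ball.1
    (hsa.eventually_analyticAt.and (hca.eventually_analyticAt.and hda.eventually_analyticAt))
  have key (n : ℕ) : ∃ a b e : ℂ → ℂ, IsJacobiTriple m a b e ∧
      MeromorphicOn a (Metric.ball 0 (2 ^ n * r)) ∧
      MeromorphicOn b (Metric.ball 0 (2 ^ n * r)) ∧
      MeromorphicOn e (Metric.ball 0 (2 ^ n * r)) := by
    induction n with
    | zero =>
      simp only [pow_zero, one_mul]
      exact ⟨s, c, d, h, fun z hz => (hball z hz).1.meromorphicAt,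
        fun z hz => (hball z hz).2.1.meromorphicAt, fun z hz => (hball z hz).2.2.meromorphicAt⟩
    | succ n ih =>
      obtain ⟨a, b, e, ht, ha, hb, he⟩ := ih
      have hcomp {f : ℂ → ℂ} (hf : MeromorphicOn f (Metric.ball 0 (2 ^ n * r))) {z : ℂ}
          (hz : z ∈ Metric.ball (0 : ℂ) (2 ^ (n + 1) * r)) :
          MeromorphicAt (fun w => f (w / 2)) z := by
        refine MeromorphicAt.comp_analyticAt (g := fun w : ℂ => w / 2) (hf _ ?_) (by fun_prop)
        simp only [mem_ball_zero_iff, norm_div, RCLike.norm_ofNat] at hz ⊢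
        rw [pow_succ] at hz
        linarith
      exact ⟨_, _, _, ht.duplication,
        fun z hz => (MeromorphicAt.duplication m (hcomp ha hz) (hcomp hb hz) (hcomp he hz)).1,
        fun z hz => (MeromorphicAt.duplication m (hcomp ha hz) (hcomp hb hz) (hcomp he hz)).2.1,
        fun z hz => (MeromorphicAt.duplication m (hcomp ha hz) (hcomp hb hz) (hcomp he hz)).2.2⟩
  have hS := exists_meromorphicNFOn_univ_of_forall_ball hsa hr fun n => by
    obtain ⟨a, b, e, ht, ha, hb, he⟩ := key n
    exact ⟨a, ha, (ht.eventuallyEq h).1⟩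
  have hC := exists_meromorphicNFOn_univ_of_forall_ball hca hr fun n => by
    obtain ⟨a, b, e, ht, ha, hb, he⟩ := key n
    exact ⟨b, hb, (ht.eventuallyEq h).2.1⟩
  have hD := exists_meromorphicNFOn_univ_of_forall_ball hda hr fun n => by
    obtain ⟨a, b, e, ht, ha, hb, he⟩ := key n
    exact ⟨e, he, (ht.eventuallyEq h).2.2⟩
  obtain ⟨S, hS, hSs⟩ := hS
  obtain ⟨C, hC, hCc⟩ := hC
  obtain ⟨D, hD, hDd⟩ := hD
  exact ⟨S, C, D, h.congr hSs hCc hDd, hS, hC, hD⟩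

/-! ### Global relations, parity and antiperiods. -/

namespace IsJacobiFunctions

variable {m : ℂ} {s c d : ℂ → ℂ}

theorem isJacobiSystemAt (h : IsJacobiFunctions m s c d) {z : ℂ} (hs : AnalyticAt ℂ s z)
    (hc : AnalyticAt ℂ c z) (hd : AnalyticAt ℂ d z) : IsJacobiSystemAt m s c d z := by
  have ms := h.sn_mero.meromorphicOn
  have mc := h.cn_mero.meromorphicOn
  have md := h.dn_mero.meromorphicOn
  have h1 : deriv s =ᶠ[𝓝 z] c * d :=
    ms.deriv.eventuallyEq_nhds_of_meromorphicNFAt (mc.mul md) (x := 0)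
      (EventuallyEq.filter_mono (h.system.mono fun w hw => hw.1.deriv) nhdsWithin_le_nhds)
      hs.deriv.meromorphicNFAt (hc.mul hd).meromorphicNFAt
  have h2 : deriv c =ᶠ[𝓝 z] -(s * d) :=
    mc.deriv.eventuallyEq_nhds_of_meromorphicNFAt (ms.mul md).neg (x := 0)
      (EventuallyEq.filter_mono (h.system.mono fun w hw => hw.2.1.deriv) nhdsWithin_le_nhds)
      hc.deriv.meromorphicNFAt (hs.mul hd).neg.meromorphicNFAt
  have h3 : deriv d =ᶠ[𝓝 z] -((fun _ => m) * (s * c)) :=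
    md.deriv.eventuallyEq_nhds_of_meromorphicNFAt
      ((MeromorphicOn.const m).mul (ms.mul mc)).neg (x := 0)
      (EventuallyEq.filter_mono (h.system.mono fun w hw => hw.2.2.deriv) nhdsWithin_le_nhds)
      hd.deriv.meromorphicNFAt (analyticAt_const.mul (hs.mul hc)).neg.meromorphicNFAt
  filter_upwards [h1, h2, h3, hs.eventually_analyticAt, hc.eventually_analyticAt,
    hd.eventually_analyticAt] with w e1 e2 e3 a1 a2 a3
  refine ⟨?_, ?_, ?_⟩
  · simpa [e1] using a1.differentiableAt.hasDerivAt
  · simpa [e2] using a2.differentiableAt.hasDerivAt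
  · simpa [e3] using a3.differentiableAt.hasDerivAt

theorem sq_add_sq (h : IsJacobiFunctions m s c d) {z : ℂ} (hs : AnalyticAt ℂ s z)
    (hc : AnalyticAt ℂ c z) : s z ^ 2 + c z ^ 2 = 1 :=
  ((((h.sn_mero.meromorphicOn.pow 2).add
    (h.cn_mero.meromorphicOn.pow 2)).eventuallyEq_nhds_of_meromorphicNFAt (MeromorphicOn.const 1)
      (x := 0) (EventuallyEq.filter_mono h.eventually_sq_add_sq nhdsWithin_le_nhds)
      ((hs.pow 2).add (hc.pow 2)).meromorphicNFAt analyticAt_const.meromorphicNFAt).eq_of_nhds :)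

theorem sq_add_mul_sq (h : IsJacobiFunctions m s c d) {z : ℂ} (hs : AnalyticAt ℂ s z)
    (hd : AnalyticAt ℂ d z) : d z ^ 2 + m * s z ^ 2 = 1 :=
  ((((h.dn_mero.meromorphicOn.pow 2).add ((MeromorphicOn.const m).mul
    (h.sn_mero.meromorphicOn.pow 2))).eventuallyEq_nhds_of_meromorphicNFAt (MeromorphicOn.const 1)
      (x := 0) (EventuallyEq.filter_mono h.eventually_sq_add_mul_sq nhdsWithin_le_nhds)
      ((hd.pow 2).add (analyticAt_const.mul (hs.pow 2))).meromorphicNFAt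
      analyticAt_const.meromorphicNFAt).eq_of_nhds :)

/-- The reflected functions solve the same initial value problem. -/
theorem neg_apply (h : IsJacobiFunctions m s c d) (z : ℂ) : s (-z) = -s z ∧ c (-z) = c z := by
  have hneg : Tendsto (fun z : ℂ => -z) (𝓝 0) (𝓝 0) := by
    simpa using (continuous_neg (G := ℂ)).tendsto 0
  have ht : IsJacobiTriple m (fun z => -s (-z)) (fun z => c (-z)) (fun z => d (-z)) := by
    refine ⟨by simp [h.sn_zero], by simp [h.cn_zero], by simp [h.dn_zero], ?_⟩
    filter_upwards [hneg.eventually h.system] with z ⟨h1, h2, h3⟩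
    have hn : HasDerivAt (fun z : ℂ => -z) (-1) z := hasDerivAt_neg z
    exact ⟨((h1.comp z hn).fun_neg).congr_deriv (by ring), (h2.comp z hn).congr_deriv (by ring),
      (h3.comp z hn).congr_deriv (by ring)⟩
  obtain ⟨e1, e2, -⟩ := h.eventuallyEq ht
  have hc : ∀ w : ℂ, AnalyticAt ℂ (fun z : ℂ => -z) w := fun w => by fun_prop
  have es := h.sn_mero.eq_of_eventuallyEq (g := fun z => -s (-z)) (x := 0)
    (fun w _ => ((h.sn_mero (Set.mem_univ _)).comp_analyticAt (hc w)).neg)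
    (e1.filter_mono nhdsWithin_le_nhds)
  have ec := h.cn_mero.eq_of_eventuallyEq (g := fun z => c (-z)) (x := 0)
    (fun w _ => (h.cn_mero (Set.mem_univ _)).comp_analyticAt (hc w))
    (e2.filter_mono nhdsWithin_le_nhds)
  exact ⟨by rw [congrFun es z, neg_neg], (congrFun ec z).symm⟩

/-- At a zero of `cn` the graphs of `sn` and `cn` are symmetric, so twice the zero is an
antiperiod. -/
theorem antiperiodic (h : IsJacobiFunctions m s c d) {K : ℂ} (hs : AnalyticAt ℂ s K)
    (hc : AnalyticAt ℂ c K) (hd : AnalyticAt ℂ d K) (hK : c K = 0) :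
    s.Antiperiodic (2 * K) ∧ c.Antiperiodic (2 * K) := by
  have hsys := h.isJacobiSystemAt hs hc hd
  have hplus : Tendsto (fun z : ℂ => z + K) (𝓝 0) (𝓝 K) := by
    have : ContinuousAt (fun z : ℂ => z + K) 0 := by fun_prop
    simpa using this.tendsto
  have hminus : Tendsto (fun z : ℂ => -z + K) (𝓝 0) (𝓝 K) := by
    have : ContinuousAt (fun z : ℂ => -z + K) 0 := by fun_prop
    simpa using this.tendsto
  have t1 : IsJacobiSystemAt m (fun z => s (z + K)) (fun z => c (z + K)) (fun z => d (z + K)) 0 := by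
    filter_upwards [hplus.eventually hsys] with z ⟨h1, h2, h3⟩
    exact ⟨h1.comp_add_const z K, h2.comp_add_const z K, h3.comp_add_const z K⟩
  have t2 : IsJacobiSystemAt m (fun z => s (-z + K)) (fun z => -c (-z + K))
      (fun z => d (-z + K)) 0 := by
    filter_upwards [hminus.eventually hsys] with z ⟨h1, h2, h3⟩
    have hn : HasDerivAt (fun z : ℂ => -z + K) (-1) z := (hasDerivAt_neg z).add_const K
    exact ⟨(h1.comp z hn).congr_deriv (by ring), ((h2.comp z hn).fun_neg).congr_deriv (by ring),
      (h3.comp z hn).congr_deriv (by ring)⟩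
  -- Translation by `K` and its reflection solve the same system; the initial values of the second
  -- components are `c K` and `-c K`, which agree as `c K = 0`. Parity then turns the symmetry about
  -- `K` into an antiperiod.
  obtain ⟨e1, e2, -⟩ := t1.eventuallyEq t2 (by simp) (by simp [hK]) (by simp)
  have hap : ∀ w : ℂ, AnalyticAt ℂ (fun z : ℂ => z + K) w := fun w => by fun_prop
  have ham : ∀ w : ℂ, AnalyticAt ℂ (fun z : ℂ => -z + K) w := fun w => by fun_prop
  have es := MeromorphicNFOn.eq_of_eventuallyEq (f := fun z => s (z + K))
    (g := fun z => s (-z + K)) (x := 0)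
    (fun w _ => (h.sn_mero (Set.mem_univ _)).comp_analyticAt (hap w))
    (fun w _ => (h.sn_mero (Set.mem_univ _)).comp_analyticAt (ham w))
    (e1.filter_mono nhdsWithin_le_nhds)
  have ec := MeromorphicNFOn.eq_of_eventuallyEq (f := fun z => c (z + K))
    (g := fun z => -c (-z + K)) (x := 0)
    (fun w _ => (h.cn_mero (Set.mem_univ _)).comp_analyticAt (hap w))
    (fun w _ => ((h.cn_mero (Set.mem_univ _)).comp_analyticAt (ham w)).neg)
    (e2.filter_mono nhdsWithin_le_nhds)
  constructor
  · intro z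
    have h1 := congrFun es (z + K)
    rw [← (h.neg_apply z).1, show z + 2 * K = z + K + K by ring, h1]
    congr 1
    ring
  · intro z
    have h1 := congrFun ec (z + K)
    rw [← (h.neg_apply z).2, show z + 2 * K = z + K + K by ring, h1]
    congr 2
    ring

end IsJacobiFunctions

/-! ### Behaviour on the real line and a zero of `cn`. -/

section Real

variable {m : ℝ} {s c d : ℂ → ℂ}

/-- As `m` is real, conjugating the argument and the value preserves the initial value problem. -/
theorem IsJacobiTriple.eventually_conj_eq (h : IsJacobiTriple (m : ℂ) s c d) :
    ∀ᶠ z in 𝓝 (0 : ℂ), starRingEnd ℂ (s (starRingEnd ℂ z)) = s z ∧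
      starRingEnd ℂ (c (starRingEnd ℂ z)) = c z ∧ starRingEnd ℂ (d (starRingEnd ℂ z)) = d z := by
  have hconj : Tendsto (starRingEnd ℂ) (𝓝 0) (𝓝 0) := by
    simpa using Complex.continuous_conj.tendsto 0
  have ht : IsJacobiTriple (m : ℂ) (starRingEnd ℂ ∘ s ∘ starRingEnd ℂ)
      (starRingEnd ℂ ∘ c ∘ starRingEnd ℂ) (starRingEnd ℂ ∘ d ∘ starRingEnd ℂ) := by
    refine ⟨by simp [h.sn_zero], by simp [h.cn_zero], by simp [h.dn_zero], ?_⟩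
    filter_upwards [hconj.eventually h.system] with z hz
    simpa only [hasDerivAt_conj_conj_iff, Function.comp_apply, map_mul, map_neg, Complex.conj_conj,
      Complex.conj_ofReal] using hz
  obtain ⟨e1, e2, e3⟩ := ht.eventuallyEq h
  filter_upwards [e1, e2, e3] with z h1 h2 h3 using ⟨h1, h2, h3⟩

/-- For `0 ≤ m < 1` the Jacobi functions are analytic and real on the real line. -/
theorem IsJacobiFunctions.analyticAt_ofReal (h : IsJacobiFunctions (m : ℂ) s c d) (hm0 : 0 ≤ m)
    (hm1 : m < 1) (x : ℝ) :
    (AnalyticAt ℂ s x ∧ AnalyticAt ℂ c x ∧ AnalyticAt ℂ d x) ∧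
      ∃ a b e : ℝ, s x = a ∧ c x = b ∧ d x = e := by
  obtain ⟨hsa, hca, hda⟩ := h.system.analyticAt
  obtain ⟨r, hr, hball⟩ := Metric.eventually_nhds_iff_ball.1
    ((hsa.eventually_analyticAt.and (hca.eventually_analyticAt.and
      hda.eventually_analyticAt)).and h.toIsJacobiTriple.eventually_conj_eq)
  have key (n : ℕ) : ∀ x : ℝ, |x| < 2 ^ n * r →
      (AnalyticAt ℂ s x ∧ AnalyticAt ℂ c x ∧ AnalyticAt ℂ d x) ∧
        ∃ a b e : ℝ, s x = a ∧ c x = b ∧ d x = e := by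
    induction n with
    | zero =>
      intro x hx
      obtain ⟨ha, h1, h2, h3⟩ := hball x (by simpa using hx)
      simp only [Complex.conj_ofReal] at h1 h2 h3
      exact ⟨ha, _, _, _, (Complex.conj_eq_iff_re.1 h1).symm, (Complex.conj_eq_iff_re.1 h2).symm,
        (Complex.conj_eq_iff_re.1 h3).symm⟩
    | succ n ih =>
      intro x hx
      obtain ⟨⟨as, ac, ad⟩, a, b, e, ha, hb, he⟩ := ih (x / 2) (by
        rw [abs_div, abs_two]
        rw [pow_succ] at hx
        linarith)
      have hrel := h.sq_add_sq as ac
      rw [ha, hb] at hrel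
      norm_cast at hrel
      -- The duplication denominator cannot vanish on the real line: `a² + b² = 1` forces `a⁴ ≤ 1`,
      -- and `0 ≤ m < 1`.
      have hN : 1 - m * a ^ 4 ≠ 0 := by
        have h1 : a ^ 2 ≤ 1 := by nlinarith
        have h2 : a ^ 4 ≤ 1 := by nlinarith [sq_nonneg a]
        nlinarith
      push_cast at as ac ad ha hb he
      have hh : AnalyticAt ℂ (fun z : ℂ => z / 2) x := by fun_prop
      have as' : AnalyticAt ℂ (fun z : ℂ => s (z / 2)) x :=
        AnalyticAt.comp (f := fun z : ℂ => z / 2) as hh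
      have ac' : AnalyticAt ℂ (fun z : ℂ => c (z / 2)) x :=
        AnalyticAt.comp (f := fun z : ℂ => z / 2) ac hh
      have ad' : AnalyticAt ℂ (fun z : ℂ => d (z / 2)) x :=
        AnalyticAt.comp (f := fun z : ℂ => z / 2) ad hh
      have hN' : (1 - m * s (x / 2) ^ 4 : ℂ) ≠ 0 := by
        rw [ha]
        exact_mod_cast hN
      have hmero {f : ℂ → ℂ} (hf : MeromorphicNFOn f Set.univ) (z : ℂ) :
          MeromorphicAt (fun w => f (w / 2)) z :=
        MeromorphicAt.comp_analyticAt (g := fun w : ℂ => w / 2)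
          (hf (Set.mem_univ _)).meromorphicAt (by fun_prop)
      have ms := hmero h.sn_mero
      have mc := hmero h.cn_mero
      have md := hmero h.dn_mero
      obtain ⟨e1, e2, e3⟩ := h.toIsJacobiTriple.eventuallyEq h.duplication
      have A1 : AnalyticAt ℂ (fun z => 2 * s (z / 2) * c (z / 2) * d (z / 2) /
          (1 - m * s (z / 2) ^ 4)) x := by fun_prop (disch := assumption)
      have A2 : AnalyticAt ℂ (fun z => (c (z / 2) ^ 2 - s (z / 2) ^ 2 * d (z / 2) ^ 2) /
          (1 - m * s (z / 2) ^ 4)) x := by fun_prop (disch := assumption)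
      have A3 : AnalyticAt ℂ (fun z => (d (z / 2) ^ 2 - m * s (z / 2) ^ 2 * c (z / 2) ^ 2) /
          (1 - m * s (z / 2) ^ 4)) x := by fun_prop (disch := assumption)
      have E1 := h.sn_mero.meromorphicOn.eventuallyEq_nhds_of_meromorphicNFAt
        (fun z _ => (MeromorphicAt.duplication m (ms z) (mc z) (md z)).1)
        (e1.filter_mono nhdsWithin_le_nhds) (h.sn_mero (Set.mem_univ _)) A1.meromorphicNFAt
      have E2 := h.cn_mero.meromorphicOn.eventuallyEq_nhds_of_meromorphicNFAt
        (fun z _ => (MeromorphicAt.duplication m (ms z) (mc z) (md z)).2.1)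
        (e2.filter_mono nhdsWithin_le_nhds) (h.cn_mero (Set.mem_univ _)) A2.meromorphicNFAt
      have E3 := h.dn_mero.meromorphicOn.eventuallyEq_nhds_of_meromorphicNFAt
        (fun z _ => (MeromorphicAt.duplication m (ms z) (mc z) (md z)).2.2)
        (e3.filter_mono nhdsWithin_le_nhds) (h.dn_mero (Set.mem_univ _)) A3.meromorphicNFAt
      refine ⟨⟨A1.congr E1.symm, A2.congr E2.symm, A3.congr E3.symm⟩,
        2 * a * b * e / (1 - m * a ^ 4), (b ^ 2 - a ^ 2 * e ^ 2) / (1 - m * a ^ 4),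
        (e ^ 2 - m * a ^ 2 * b ^ 2) / (1 - m * a ^ 4), ?_, ?_, ?_⟩
      · rw [E1.eq_of_nhds, ha, hb, he]; push_cast; rfl
      · rw [E2.eq_of_nhds, ha, hb, he]; push_cast; rfl
      · rw [E3.eq_of_nhds, ha, hb, he]; push_cast; rfl
  obtain ⟨n, hn⟩ := pow_unbounded_of_one_lt (|x| / r) (one_lt_two : (1 : ℝ) < 2)
  exact key n x ((div_lt_iff₀ hr).1 hn)

/-- For `0 ≤ m < 1` the function `cn` has a positive zero. -/
theorem IsJacobiFunctions.exists_cn_eq_zero (h : IsJacobiFunctions (m : ℂ) s c d) (hm0 : 0 ≤ m)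
    (hm1 : m < 1) : ∃ K : ℝ, 0 < K ∧ c K = 0 := by
  have han (x : ℝ) := (h.analyticAt_ofReal hm0 hm1 x).1
  choose S C D hS hC hD using fun x => (h.analyticAt_ofReal hm0 hm1 x).2
  have hsys (x : ℝ) : HasDerivAt S (C x * D x) x ∧ HasDerivAt C (-(S x * D x)) x ∧
      HasDerivAt D (-(m * (S x * C x))) x := by
    obtain ⟨h1, h2, h3⟩ :=
      (h.isJacobiSystemAt (han x).1 (han x).2.1 (han x).2.2).self_of_nhds
    have h1 := h1.real_of_complex
    have h2 := h2.real_of_complex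
    have h3 := h3.real_of_complex
    simp only [hS, hC, hD] at h1 h2 h3
    norm_cast at h1 h2 h3
  have hsc (x : ℝ) : S x ^ 2 + C x ^ 2 = 1 := by
    have := h.sq_add_sq (han x).1 (han x).2.1
    rw [hS, hC] at this
    exact_mod_cast this
  have hsd (x : ℝ) : D x ^ 2 + m * S x ^ 2 = 1 := by
    have := h.sq_add_mul_sq (han x).1 (han x).2.2
    rw [hS, hD] at this
    exact_mod_cast this
  have hS0 : S 0 = 0 := by have := hS 0; simp [h.sn_zero] at this; exact_mod_cast this.symm
  have hC0 : C 0 = 1 := by have := hC 0; simp [h.cn_zero] at this; exact_mod_cast this.symm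
  have hD0 : D 0 = 1 := by have := hD 0; simp [h.dn_zero] at this; exact_mod_cast this.symm
  have hScont : Continuous S := continuous_iff_continuousAt.2 fun x => (hsys x).1.continuousAt
  have hCcont : Continuous C := continuous_iff_continuousAt.2 fun x => (hsys x).2.1.continuousAt
  have hDcont : Continuous D := continuous_iff_continuousAt.2 fun x => (hsys x).2.2.continuousAt
  have hD2 (x : ℝ) : 1 - m ≤ D x ^ 2 := by
    have := hsc x
    have := hsd x
    nlinarith [sq_nonneg (C x)]
  -- `D` starts at `1` and cannot cross zero because `D² ≥ 1 - m > 0`. A positive `D` below `1 - m ≤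
  -- 1` would have a square below `1 - m`.
  have hDpos (x : ℝ) : 1 - m ≤ D x := by
    have hpos : 0 < D x := by
      by_contra hneg
      obtain ⟨y, hy⟩ := mem_range_of_exists_le_of_exists_ge hDcont ⟨x, not_lt.1 hneg⟩
        ⟨0, by rw [hD0]; exact zero_le_one⟩
      have := hD2 y
      rw [hy] at this
      linarith
    by_contra hlt
    have := hD2 x
    nlinarith
  suffices hneg : ∃ x, 0 ≤ x ∧ C x ≤ 0 by
    obtain ⟨x, hx0, hx⟩ := hneg
    obtain ⟨K, hK, hCK⟩ := intermediate_value_Icc' hx0 hCcont.continuousOn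
      ⟨hx, by rw [hC0]; exact zero_le_one⟩
    refine ⟨K, lt_of_le_of_ne hK.1 fun h0 => ?_, by rw [hC, hCK, Complex.ofReal_zero]⟩
    rw [← h0, hC0] at hCK
    exact one_ne_zero hCK
  -- If `C` stayed positive, `S` would increase, so beyond `1` one has `C' = -S D ≤ -δ`. As `C 1 ≤
  -- 1`, `C` would be nonpositive at `1 + 1 / δ`.
  by_contra! hpos
  have hSmono : StrictMonoOn S (Set.Ici 0) := by
    refine strictMonoOn_of_deriv_pos (convex_Ici 0) hScont.continuousOn fun x hx => ?_
    rw [interior_Ici] at hx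
    rw [(hsys x).1.deriv]
    exact mul_pos (hpos x (le_of_lt hx)) (by linarith [hDpos x])
  have hS1 : 0 < S 1 := by
    have := hSmono (Set.mem_Ici.2 le_rfl) (Set.mem_Ici.2 zero_le_one) zero_lt_one
    rwa [hS0] at this
  set δ := S 1 * (1 - m) with hδ
  have hδpos : 0 < δ := mul_pos hS1 (by linarith)
  have hanti : AntitoneOn (fun x => C x + δ * x) (Set.Ici 1) := by
    refine antitoneOn_of_deriv_nonpos (convex_Ici 1) (by fun_prop)
      (fun x _ => (((hsys x).2.1.differentiableAt).add
        (differentiableAt_id.const_mul δ)).differentiableWithinAt) fun x hx => ?_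
    rw [interior_Ici] at hx
    have hx1 : (1 : ℝ) < x := hx
    have h1 : S 1 ≤ S x := (hSmono (Set.mem_Ici.2 zero_le_one)
      (Set.mem_Ici.2 (by linarith)) hx1).le
    have h2 : HasDerivAt (fun x => C x + δ * x) (-(S x * D x) + δ * 1) x :=
      (hsys x).2.1.fun_add ((hasDerivAt_id x).const_mul δ)
    rw [h2.deriv]
    have := mul_le_mul h1 (hDpos x) (by linarith) (by linarith)
    linarith
  have h1 : (1 : ℝ) ≤ 1 + 1 / δ := by
    have : 0 < 1 / δ := by positivity
    linarith
  have h2 := hanti (Set.mem_Ici.2 le_rfl) (Set.mem_Ici.2 h1) h1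
  have h3 := hpos (1 + 1 / δ) (by linarith)
  have h4 : C 1 ≤ 1 := by nlinarith [hsc 1, sq_nonneg (S 1)]
  have h5 : δ * (1 + 1 / δ) = δ + 1 := by field_simp
  simp only [h5] at h2
  linarith

/-- For `0 ≤ m < 1` the functions `sn` and `cn` have a positive antiperiod. -/
theorem IsJacobiFunctions.exists_antiperiodic (h : IsJacobiFunctions (m : ℂ) s c d) (hm0 : 0 ≤ m)
    (hm1 : m < 1) : ∃ L : ℝ, 0 < L ∧ s.Antiperiodic L ∧ c.Antiperiodic L := by
  obtain ⟨K, hK0, hK⟩ := h.exists_cn_eq_zero hm0 hm1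
  obtain ⟨h1, h2, h3⟩ := (h.analyticAt_ofReal hm0 hm1 K).1
  refine ⟨2 * K, by linarith, ?_⟩
  simpa using h.antiperiodic h1 h2 h3 hK

end Real

/-! ### The imaginary period. -/

/-- The normal form of a periodic meromorphic function is periodic. -/
theorem MeromorphicNFOn.periodic_of_eventuallyEq {f F : ℂ → ℂ} (hf : MeromorphicNFOn f Set.univ)
    (hF : MeromorphicOn F Set.univ) (h : f =ᶠ[𝓝[≠] 0] F) {ω : ℂ} (hω : F.Periodic ω) :
    f.Periodic ω := by
  have h' : f =ᶠ[𝓝[≠] ω] F :=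
    hf.meromorphicOn.eventuallyEq_nhdsNE_of_isPreconnected hF isPreconnected_univ
      (Set.mem_univ _) (Set.mem_univ _) h
  have htrans : Tendsto (fun z : ℂ => z + ω) (𝓝[≠] 0) (𝓝[≠] ω) := by
    refine tendsto_nhdsWithin_of_tendsto_nhds_of_eventually_within _ ?_ ?_
    · have : ContinuousAt (fun z : ℂ => z + ω) 0 := by fun_prop
      simpa using tendsto_nhdsWithin_of_tendsto_nhds this.tendsto
    · filter_upwards [self_mem_nhdsWithin] with z hz
      simpa using hz
  have ha : ∀ w : ℂ, AnalyticAt ℂ (fun z : ℂ => z + ω) w := fun w => by fun_prop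
  refine fun z => congrFun (MeromorphicNFOn.eq_of_eventuallyEq (f := fun z => f (z + ω))
    (x := 0) (fun w _ => (hf (Set.mem_univ _)).comp_analyticAt (ha w)) hf ?_) z
  filter_upwards [h, htrans.eventually h'] with z h1 h2
  rw [h1, h2, hω]

/-- Jacobi's imaginary transformation. -/
theorem IsJacobiTriple.imaginary {m m' : ℂ} {s c d : ℂ → ℂ} (h : IsJacobiTriple m' s c d)
    (hm : m + m' = 1) :
    IsJacobiTriple m (fun z => Complex.I * s (-Complex.I * z) / c (-Complex.I * z))
      (fun z => 1 / c (-Complex.I * z)) (fun z => d (-Complex.I * z) / c (-Complex.I * z)) := by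
  refine ⟨by simp [h.sn_zero], by simp [h.cn_zero], by simp [h.cn_zero, h.dn_zero], ?_⟩
  have hc0 : ∀ᶠ z in 𝓝 (0 : ℂ), c z ≠ 0 :=
    h.system.analyticAt.2.1.continuousAt.eventually_ne (by simp [h.cn_zero])
  have hrot : Tendsto (fun z : ℂ => -Complex.I * z) (𝓝 0) (𝓝 0) := by
    have : ContinuousAt (fun z : ℂ => -Complex.I * z) 0 := by fun_prop
    simpa using this.tendsto
  filter_upwards [hrot.eventually h.system, hrot.eventually hc0,
    hrot.eventually h.eventually_sq_add_sq, hrot.eventually h.eventually_sq_add_mul_sq]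
    with z ⟨h1, h2, h3⟩ h0 hsc hsd
  have hh : HasDerivAt (fun z : ℂ => -Complex.I * z) (-Complex.I) z := by
    simpa using (hasDerivAt_id z).const_mul (-Complex.I)
  have hs := h1.comp z hh
  have hc := h2.comp z hh
  have hd := h3.comp z hh
  have hI := Complex.I_sq
  obtain rfl : m = 1 - m' := eq_sub_of_add_eq hm
  refine ⟨((hs.const_mul Complex.I).fun_div hc h0).congr_deriv ?_,
    ((hasDerivAt_const z (1 : ℂ)).fun_div hc h0).congr_deriv ?_,
    (hd.fun_div hc h0).congr_deriv ?_⟩ <;>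
  · simp only [Function.comp_apply]
    generalize s (-Complex.I * z) = x at *
    generalize c (-Complex.I * z) = y at *
    generalize d (-Complex.I * z) = w at *
    generalize Complex.I = i at *
    field_simp
    grind

/-- In the quotient `s' / c'` of the imaginary transformation the two sign changes cancel, so a
common antiperiod becomes a period, rotated by `I`. -/
theorem IsJacobiFunctions.periodic_I_mul {m m' : ℂ} {s c d s' c' d' : ℂ → ℂ}
    (h : IsJacobiFunctions m s c d) (h' : IsJacobiFunctions m' s' c' d') (hm : m + m' = 1)
    {L : ℂ} (hs : s'.Antiperiodic L) (hc : c'.Antiperiodic L) :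
    s.Periodic (Complex.I * L) := by
  set F : ℂ → ℂ := fun z => Complex.I * s' (-Complex.I * z) / c' (-Complex.I * z) with hF
  have hFper : F.Periodic (Complex.I * L) := by
    intro z
    have : -Complex.I * (z + Complex.I * L) = -Complex.I * z + L := by
      linear_combination (-L) * Complex.I_sq
    simp only [hF, this, hs _, hc _]
    ring
  have hcomp {f : ℂ → ℂ} (hf : MeromorphicNFOn f Set.univ) (z : ℂ) :
      MeromorphicAt (fun w => f (-Complex.I * w)) z :=
    MeromorphicAt.comp_analyticAt (g := fun w : ℂ => -Complex.I * w)
      (hf (Set.mem_univ _)).meromorphicAt (by fun_prop)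
  have hFmero : MeromorphicOn F Set.univ := fun z _ =>
    ((MeromorphicAt.const Complex.I z).mul (hcomp h'.sn_mero z)).div (hcomp h'.cn_mero z)
  have hsF : s =ᶠ[𝓝[≠] 0] F :=
    (h.eventuallyEq (h'.imaginary hm)).1.filter_mono nhdsWithin_le_nhds
  exact h.sn_mero.periodic_of_eventuallyEq hFmero hsF hFper

/-! ### The amplitude and the Jacobi sine. -/

theorem HasDerivAt.cpow_one_half {u : ℂ → ℂ} {u' z : ℂ} (hu : HasDerivAt u u' z)
    (hz : u z ∈ Complex.slitPlane) :
    HasDerivAt (fun z => u z ^ (1 / 2 : ℂ)) (u' / (2 * u z ^ (1 / 2 : ℂ))) z := by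
  have h0 : u z ≠ 0 := Complex.slitPlane_ne_zero hz
  refine (hu.cpow_const (c := 1 / 2) hz).congr_deriv ?_
  rw [show (1 / 2 - 1 : ℂ) = -(1 / 2) by norm_num, Complex.cpow_neg]
  have : u z ^ (1 / 2 : ℂ) ≠ 0 := by simp [Complex.cpow_eq_zero_iff, h0]
  field_simp

theorem Complex.cpow_one_half_sq (z : ℂ) : (z ^ (1 / 2 : ℂ)) ^ 2 = z := by
  simp

theorem analyticAt_incompleteEllipticIntegral_integrand (k : ℝ) :
    AnalyticAt ℂ (fun θ => ((1 - (k : ℂ) ^ 2 * Complex.sin θ ^ 2) ^ (1 / 2 : ℂ))⁻¹) 0 := by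
  have h1 : AnalyticAt ℂ (fun θ => 1 - (k : ℂ) ^ 2 * Complex.sin θ ^ 2) 0 := by fun_prop
  exact (h1.cpow analyticAt_const (by simp)).inv (by simp)

theorem exists_isAnalyticLocalInverse_incompleteEllipticIntegral (k : ℝ) :
    ∃ am, IsAnalyticLocalInverse (incompleteEllipticIntegral k) am := by
  have hg := analyticAt_incompleteEllipticIntegral_integrand k
  refine exists_isAnalyticLocalInverse (analyticAt_integralFromZero hg)
    (integralFromZero_zero _) ?_
  have h1 := (eventually_hasDerivAt_integralFromZero hg).self_of_nhds.deriv
  have h2 : deriv (incompleteEllipticIntegral k) 0 = 1 := h1.trans (by simp)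
  exact h2 ▸ one_ne_zero

/-- Inverting the integral gives `am' = √(1 - k² sin² am)`, which is the third function of the
triple; the system follows by the chain rule. -/
theorem IsAnalyticLocalInverse.isJacobiTriple {k : ℝ} {am : ℂ → ℂ}
    (h : IsAnalyticLocalInverse (incompleteEllipticIntegral k) am) :
    IsJacobiTriple ((k : ℂ) ^ 2) (fun z => Complex.sin (am z)) (fun z => Complex.cos (am z))
      (fun z => (1 - (k : ℂ) ^ 2 * Complex.sin (am z) ^ 2) ^ (1 / 2 : ℂ)) := by
  refine ⟨by simp [h.map_zero], by simp [h.map_zero], by simp [h.map_zero], ?_⟩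
  have hslit : ∀ᶠ z in 𝓝 (0 : ℂ), 1 - (k : ℂ) ^ 2 * Complex.sin (am z) ^ 2 ∈ Complex.slitPlane := by
    have h1 := h.analyticAt.continuousAt
    have h2 : ContinuousAt (fun z => 1 - (k : ℂ) ^ 2 * Complex.sin (am z) ^ 2) 0 := by fun_prop
    exact h2.preimage_mem_nhds (Complex.isOpen_slitPlane.mem_nhds (by simp [h.map_zero]))
  have ham := h.eventually_hasDerivAt (eventually_hasDerivAt_integralFromZero
    (analyticAt_incompleteEllipticIntegral_integrand k))
  filter_upwards [ham, hslit] with z ⟨h0, h1⟩ h2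
  rw [inv_inv] at h1
  have hD : (1 - (k : ℂ) ^ 2 * Complex.sin (am z) ^ 2) ^ (1 / 2 : ℂ) ≠ 0 :=
    fun h => h0 (inv_eq_zero.2 h)
  refine ⟨h1.csin, h1.ccos.congr_deriv (by ring), ?_⟩
  refine ((((h1.csin.fun_pow 2).const_mul ((k : ℂ) ^ 2)).const_sub 1).cpow_one_half h2).congr_deriv
    ?_
  field_simp
  push_cast
  ring

/-- The Jacobi sine is the first member of the unique triple of Jacobi functions. -/
theorem isJacobiSn_iff {k : ℝ} {s c d : ℂ → ℂ} (h : IsJacobiFunctions ((k : ℂ) ^ 2) s c d)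
    (f : ℂ → ℂ) : IsJacobiSn k f ↔ f = s := by
  constructor
  · rintro ⟨hf, am, ham, hfam⟩
    exact MeromorphicNFOn.eq_of_eventuallyEq hf h.sn_mero (x := 0)
      ((EventuallyEq.trans hfam (ham.isJacobiTriple.eventuallyEq h.toIsJacobiTriple).1).filter_mono
        nhdsWithin_le_nhds)
  · rintro rfl
    obtain ⟨am, ham⟩ := exists_isAnalyticLocalInverse_incompleteEllipticIntegral k
    exact ⟨h.sn_mero, am, ham, (h.toIsJacobiTriple.eventuallyEq ham.isJacobiTriple).1⟩

theorem exists_isJacobiFunctions (k : ℝ) :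
    ∃ s c d, IsJacobiFunctions ((k : ℂ) ^ 2) s c d := by
  obtain ⟨am, ham⟩ := exists_isAnalyticLocalInverse_incompleteEllipticIntegral k
  exact ham.isJacobiTriple.exists_isJacobiFunctions

/-- For `0 < k < 1` the square of `sn` has a real and a purely imaginary period. -/
theorem IsJacobiFunctions.exists_periods {k : ℝ} {s c d : ℂ → ℂ}
    (h : IsJacobiFunctions ((k : ℂ) ^ 2) s c d) (hk0 : 0 < k) (hk1 : k < 1) :
    ∃ L L' : ℝ, 0 < L ∧ 0 < L' ∧ (∀ z, s (z + L) ^ 2 = s z ^ 2) ∧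
      ∀ z, s (z + Complex.I * L') ^ 2 = s z ^ 2 := by
  have hk2 : k ^ 2 < 1 := by nlinarith
  have hk2' : 0 < k ^ 2 := by positivity
  -- The complementary modulus, whose square is `1 - k²`.
  obtain ⟨s', c', d', h'⟩ := exists_isJacobiFunctions (Real.sqrt (1 - k ^ 2))
  have hsqrt : ((Real.sqrt (1 - k ^ 2) : ℝ) : ℂ) ^ 2 = ((1 - k ^ 2 : ℝ) : ℂ) := by
    rw [← Complex.ofReal_pow, Real.sq_sqrt (by linarith)]
  rw [hsqrt] at h'
  have h1 : IsJacobiFunctions ((k ^ 2 : ℝ) : ℂ) s c d := by rwa [Complex.ofReal_pow]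
  obtain ⟨L, hL, hs, -⟩ := h1.exists_antiperiodic hk2'.le hk2
  obtain ⟨L', hL', hs', hc'⟩ := h'.exists_antiperiodic (by linarith) (by linarith)
  have hper := h1.periodic_I_mul h' (by push_cast; ring) hs' hc'
  exact ⟨L, L', hL, hL', fun z => by rw [hs z, neg_sq], fun z => by rw [hper z]⟩

/-! ### The hypergeometric function in closed form. -/

theorem hasSum_one_sub_cpow_neg_one_half {x : ℂ} (hx : ‖x‖ < 1) :
    HasSum (fun n : ℕ => ((n.factorial : ℂ)⁻¹ * (ascPochhammer ℂ n).eval (1 / 2)) * x ^ n)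
      ((1 - x) ^ (-(1 / 2) : ℂ)) := by
  have h := (Complex.one_add_cpow_hasFPowerSeriesOnBall_zero (a := -(1 / 2))).hasSum (y := -x)
    (by rw [← ENNReal.ofReal_one, Metric.eball_ofReal]; simpa using hx)
  -- The parameter `b` occurs above and below and cancels; `b = 1` keeps its Pochhammer symbols
  -- nonzero.
  rw [binomialSeries_eq_ordinaryHypergeometricSeries (b := 1)
    (fun k hk => by
      have : ((k + 1 : ℕ) : ℂ) = 0 := by push_cast; rw [hk]; ring
      exact Nat.succ_ne_zero k (Nat.cast_eq_zero.1 this))] at h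
  have hterm (n : ℕ) : ((ordinaryHypergeometricSeries ℂ (- -(1 / 2)) 1 1).compContinuousLinearMap
      (-ContinuousLinearMap.id ℂ ℂ) n) (fun _ => -x) =
      ((n.factorial : ℂ)⁻¹ * (ascPochhammer ℂ n).eval (1 / 2)) * x ^ n := by
    have h1 : (ascPochhammer ℂ n).eval (1 : ℂ) ≠ 0 := by
      rw [ascPochhammer_eval_one]
      exact_mod_cast n.factorial_ne_zero
    have h2 := ordinaryHypergeometricSeries_apply_eq (𝔸 := ℂ) (1 / 2 : ℂ) 1 1 x n
    have h3 : (⇑(-ContinuousLinearMap.id ℂ ℂ) ∘ fun _ : Fin n => -x) = fun _ => x := by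
      funext i
      simp
    rw [FormalMultilinearSeries.compContinuousLinearMap_apply, neg_neg, h3, h2,
      mul_inv_cancel_right₀ h1, smul_eq_mul]
  simp only [hterm, zero_add] at h
  rw [← sub_eq_add_neg] at h
  exact h

/-- Both `(1/2)_{2n} = 4ⁿ (1/4)_n (3/4)_n` and `(2n)! = 4ⁿ n! (1/2)_n` split by parity of the
factors; the induction compares consecutive ratios. -/
theorem ordinaryHypergeometricCoefficient_quarter (n : ℕ) :
    ((2 * n).factorial : ℂ)⁻¹ * (ascPochhammer ℂ (2 * n)).eval (1 / 2) =
      ordinaryHypergeometricCoefficient (1 / 4 : ℂ) (3 / 4) (1 / 2) n := by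
  have hhalf (n : ℕ) : (ascPochhammer ℂ n).eval (1 / 2 : ℂ) ≠ 0 := by
    rw [Ne, ascPochhammer_eval_eq_zero_iff]
    rintro ⟨k, -, hk⟩
    have h2 : (((2 * k + 1 : ℕ)) : ℂ) = 0 := by push_cast; rw [hk]; ring
    exact Nat.succ_ne_zero _ (Nat.cast_eq_zero.1 h2)
  induction n with
  | zero => simp [ordinaryHypergeometricCoefficient]
  | succ n ih =>
    have h1 : ((2 * n + 1 : ℕ) : ℂ) ≠ 0 := Nat.cast_ne_zero.2 (by omega)
    have h2 : ((n + 1 : ℕ) : ℂ) ≠ 0 := Nat.cast_ne_zero.2 (by omega)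
    have h3 := hhalf n
    have h4 : (n.factorial : ℂ) ≠ 0 := Nat.cast_ne_zero.2 n.factorial_ne_zero
    have h5 : ((2 * n).factorial : ℂ) ≠ 0 := Nat.cast_ne_zero.2 (2 * n).factorial_ne_zero
    have h6 : (1 / 2 + n : ℂ) ≠ 0 := by
      intro h
      apply h1
      push_cast
      linear_combination 2 * h
    rw [ordinaryHypergeometricCoefficient, show 2 * (n + 1) = 2 * n + 1 + 1 by ring,
      Nat.factorial_succ, Nat.factorial_succ, Nat.factorial_succ n, ascPochhammer_succ_eval, ascPochhammer_succ_eval,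
      ascPochhammer_succ_eval, ascPochhammer_succ_eval, ascPochhammer_succ_eval]
    simp only [ordinaryHypergeometricCoefficient] at ih
    push_cast at *
    generalize (ascPochhammer ℂ (2 * n)).eval (1 / 2 : ℂ) = P at *
    generalize (ascPochhammer ℂ n).eval (1 / 2 : ℂ) = Q at *
    generalize (ascPochhammer ℂ n).eval (1 / 4 : ℂ) = R at *
    generalize (ascPochhammer ℂ n).eval (3 / 4 : ℂ) = S at *
    generalize (n.factorial : ℂ) = f at *
    generalize ((2 * n).factorial : ℂ) = g at *
    obtain rfl : P = g * (f⁻¹ * R * S * Q⁻¹) := by rw [← ih, mul_inv_cancel_left₀ h5]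
    have h7 : (2 * n + 1 + 1 : ℂ) ≠ 0 := by
      intro h
      apply h2
      linear_combination h / 2
    have h8 : (1 + 2 * n : ℂ) ≠ 0 := by rwa [add_comm]
    field_simp
    ring

theorem analyticAt_ordinaryHypergeometric_quarter :
    AnalyticAt ℂ (ordinaryHypergeometric (1 / 4 : ℂ) (3 / 4 : ℂ) (1 / 2 : ℂ)) (0 : ℂ) := by
  have hrad : (ordinaryHypergeometricSeries ℂ (1 / 4 : ℂ) (3 / 4) (1 / 2)).radius = 1 := by
    refine ordinaryHypergeometricSeries_radius_eq_one ℂ _ _ _ fun n => ?_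
    refine ⟨fun h => ?_, fun h => ?_, fun h => ?_⟩ <;>
    · have h1 := congrArg Complex.re h
      norm_num at h1
      have : (0 : ℝ) ≤ n := n.cast_nonneg
      linarith
  exact (FormalMultilinearSeries.hasFPowerSeriesOnBall _ (by rw [hrad]; exact one_pos)).analyticAt

/-- Adding the binomial series at `x` and `-x` kills the odd terms and doubles the even ones. -/
theorem ordinaryHypergeometric_quarter_sq {x : ℂ} (hx : ‖x‖ < 1) :
    2 * ordinaryHypergeometric (1 / 4 : ℂ) (3 / 4 : ℂ) (1 / 2 : ℂ) (x ^ 2) =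
      (1 - x) ^ (-(1 / 2) : ℂ) + (1 + x) ^ (-(1 / 2) : ℂ) := by
  have h1 := (hasSum_one_sub_cpow_neg_one_half hx).add
    (hasSum_one_sub_cpow_neg_one_half (x := -x) (by simpa using hx))
  rw [sub_neg_eq_add] at h1
  have hinj : Function.Injective (fun n : ℕ => 2 * n) := fun a b hab => by
    simpa using hab
  rw [← hinj.hasSum_iff] at h1
  · rw [ordinaryHypergeometric_eq_tsum, ← tsum_mul_left, ← h1.tsum_eq]
    refine tsum_congr fun n => ?_
    have h2 := ordinaryHypergeometricCoefficient_quarter n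
    simp only [Function.comp_apply, smul_eq_mul, (even_two_mul n).neg_pow, ← two_mul, h2,
      ← pow_mul, ordinaryHypergeometricCoefficient]
  · intro n hn
    have hodd : Odd n := by
      rw [← Nat.not_even_iff_odd]
      rintro ⟨k, rfl⟩
      exact hn ⟨k, (two_mul k)⟩
    rw [hodd.neg_pow]
    ring

/-- With `x = sin w`, both `1 ∓ x` are the squares `(cos (w/2) ∓ sin (w/2))²`, so the roots
disappear. -/
theorem eventually_ordinaryHypergeometric_sin_sq : ∀ᶠ w in 𝓝 (0 : ℂ),
    ordinaryHypergeometric (1 / 4 : ℂ) (3 / 4 : ℂ) (1 / 2 : ℂ) (Complex.sin w ^ 2) =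
      Complex.cos (w / 2) / Complex.cos w := by
  have c1 : ContinuousAt (fun w : ℂ => ‖Complex.sin w‖) 0 := by fun_prop
  have c2 : ContinuousAt (fun w : ℂ => (Complex.cos (w / 2) - Complex.sin (w / 2)).re) 0 := by
    fun_prop
  have c3 : ContinuousAt (fun w : ℂ => (Complex.cos (w / 2) + Complex.sin (w / 2)).re) 0 := by
    fun_prop
  filter_upwards [c1.eventually_lt_const (u := 1) (by simp),
    c2.eventually_const_lt (u := 0) (by simp), c3.eventually_const_lt (u := 0) (by simp)]
    with w h1 h2 h3
  have h4 := ordinaryHypergeometric_quarter_sq h1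
  have hw : w = 2 * (w / 2) := by ring
  have e2 : 1 - Complex.sin w = (Complex.cos (w / 2) - Complex.sin (w / 2)) ^ 2 := by
    conv_lhs => rw [hw, Complex.sin_two_mul]
    linear_combination -Complex.sin_sq_add_cos_sq (w / 2)
  have e3 : 1 + Complex.sin w = (Complex.cos (w / 2) + Complex.sin (w / 2)) ^ 2 := by
    conv_lhs => rw [hw, Complex.sin_two_mul]
    linear_combination -Complex.sin_sq_add_cos_sq (w / 2)
  have e4 : Complex.cos w = (Complex.cos (w / 2) - Complex.sin (w / 2)) *
      (Complex.cos (w / 2) + Complex.sin (w / 2)) := by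
    conv_lhs => rw [hw, Complex.cos_two_mul']
    ring
  -- The principal root returns `x` itself, because near `w = 0` both bases have positive real part.
  have hroot {x : ℂ} (hx : 0 < x.re) : (x ^ 2) ^ (-(1 / 2) : ℂ) = x⁻¹ := by
    rw [Complex.cpow_neg, one_div, Complex.sq_cpow_two_inv hx]
  rw [e2, e3, hroot h2, hroot h3] at h4
  have n2 : Complex.cos (w / 2) - Complex.sin (w / 2) ≠ 0 := fun h => by simp [h] at h2
  have n3 : Complex.cos (w / 2) + Complex.sin (w / 2) ≠ 0 := fun h => by simp [h] at h3
  rw [e4]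
  field_simp at h4 ⊢
  linear_combination h4 / 2

/-! ### Shen's function as a Jacobi function. -/

theorem analyticAt_shenIntegral_integrand (κ : ℝ) :
    AnalyticAt ℂ (fun t => ordinaryHypergeometric (1 / 4 : ℂ) (3 / 4 : ℂ) (1 / 2 : ℂ)
      ((κ : ℂ) ^ 2 * Complex.sin t ^ 2)) 0 := by
  have h1 : AnalyticAt ℂ (fun t => (κ : ℂ) ^ 2 * Complex.sin t ^ 2) 0 := by fun_prop
  exact analyticAt_ordinaryHypergeometric_quarter.comp_of_eq h1 (by simp)

theorem exists_isAnalyticLocalInverse_shenIntegral (κ : ℝ) :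
    ∃ φ, IsAnalyticLocalInverse (shenIntegral κ) φ := by
  have hg := analyticAt_shenIntegral_integrand κ
  refine exists_isAnalyticLocalInverse (analyticAt_integralFromZero hg)
    (integralFromZero_zero _) ?_
  have h1 := (eventually_hasDerivAt_integralFromZero hg).self_of_nhds.deriv
  have h2 : deriv (shenIntegral κ) 0 = 1 := h1.trans (by simp)
  exact h2 ▸ one_ne_zero

theorem exists_sin_eq_mul_sin {φ : ℂ → ℂ} (hφ : AnalyticAt ℂ φ 0) (hφ0 : φ 0 = 0) (κ : ℂ) :
    ∃ ψ : ℂ → ℂ, AnalyticAt ℂ ψ 0 ∧ ψ 0 = 0 ∧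
      ∀ᶠ z in 𝓝 (0 : ℂ), Complex.sin (ψ z) = κ * Complex.sin (φ z) := by
  obtain ⟨σ, hσ⟩ := exists_isAnalyticLocalInverse (f := Complex.sin) (by fun_prop) (by simp)
    (by simp [Complex.deriv_sin])
  have h1 : AnalyticAt ℂ (fun z => κ * Complex.sin (φ z)) 0 := by fun_prop
  have h2 : Tendsto (fun z => κ * Complex.sin (φ z)) (𝓝 0) (𝓝 0) := by
    simpa [hφ0] using h1.continuousAt.tendsto
  refine ⟨fun z => σ (κ * Complex.sin (φ z)), ?_, by simp [hφ0, hσ.map_zero],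
    h2.eventually hσ.right_inv⟩
  exact AnalyticAt.comp (f := fun z => κ * Complex.sin (φ z))
    (by simpa [hφ0] using hσ.analyticAt) h1

/-- The derivatives of `φ` and `ψ` in terms of `ψ`. -/
theorem IsAnalyticLocalInverse.eventually_hasDerivAt_shen {κ : ℝ} {φ ψ : ℂ → ℂ}
    (hφ : IsAnalyticLocalInverse (shenIntegral κ) φ) (hψ : AnalyticAt ℂ ψ 0) (hψ0 : ψ 0 = 0)
    (hsin : ∀ᶠ z in 𝓝 (0 : ℂ), Complex.sin (ψ z) = (κ : ℂ) * Complex.sin (φ z)) :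
    ∀ᶠ z in 𝓝 (0 : ℂ), Complex.cos (ψ z / 2) ≠ 0 ∧
      HasDerivAt ψ ((κ : ℂ) * Complex.cos (φ z) / Complex.cos (ψ z / 2)) z := by
  have hψt : Tendsto ψ (𝓝 0) (𝓝 0) := by simpa [hψ0] using hψ.continuousAt.tendsto
  have hψc := hψ.continuousAt
  have c1 : ContinuousAt (fun z => Complex.cos (ψ z / 2)) 0 := by fun_prop
  have c2 : ContinuousAt (fun z => Complex.cos (ψ z)) 0 := by fun_prop
  have n1 : ∀ᶠ z in 𝓝 (0 : ℂ), Complex.cos (ψ z / 2) ≠ 0 := c1.eventually_ne (by simp [hψ0])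
  have n2 : ∀ᶠ z in 𝓝 (0 : ℂ), Complex.cos (ψ z) ≠ 0 := c2.eventually_ne (by simp [hψ0])
  filter_upwards [hφ.eventually_hasDerivAt (eventually_hasDerivAt_integralFromZero
      (analyticAt_shenIntegral_integrand κ)), hsin.eventually_nhds,
    hψt.eventually eventually_ordinaryHypergeometric_sin_sq, hψ.eventually_analyticAt,
    n1, n2]
    with z ⟨_, h1⟩ h2 h3 h4 h5 h6
  refine ⟨h5, ?_⟩
  -- The integrand depends on `κ² sin² φ = sin² ψ`, so the closed form gives `φ' = cos ψ / cos
  -- (ψ/2)`.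
  rw [← mul_pow, ← h2.self_of_nhds, h3] at h1
  have h7 := h4.differentiableAt.hasDerivAt
  have h8 : Complex.cos (ψ z) * deriv ψ z =
      κ * (Complex.cos (φ z) * (Complex.cos (ψ z / 2) / Complex.cos (ψ z))⁻¹) :=
    h7.csin.unique ((h1.csin.const_mul (κ : ℂ)).congr_of_eventuallyEq h2)
  refine h7.congr_deriv ?_
  field_simp at h8 ⊢
  linear_combination h8

/-- The core computation: in `S'` the factor `cos (ψ/2)` cancels, and `aκ = 2μ` leaves `cos φ(z/μ)`.
The condition `a²(1 - λ) = 2` makes `cos² φ` factor as `(1 - S²)(1 - mS²)`. -/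
theorem IsAnalyticLocalInverse.isJacobiTriple_shen {κ lam μ a : ℝ} {φ ψ : ℂ → ℂ}
    (hφ : IsAnalyticLocalInverse (shenIntegral κ) φ) (hψ : AnalyticAt ℂ ψ 0) (hψ0 : ψ 0 = 0)
    (hsin : ∀ᶠ z in 𝓝 (0 : ℂ), Complex.sin (ψ z) = (κ : ℂ) * Complex.sin (φ z))
    (hκ : κ ^ 2 = (1 - lam) * (1 + lam)) (hκ0 : κ ≠ 0) (ha : a * κ = 2 * μ)
    (ha2 : a ^ 2 * (1 - lam) = 2) (hμ : μ ≠ 0) :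
    ∃ C D : ℂ → ℂ, IsJacobiTriple (((1 - lam) / (1 + lam) : ℝ) : ℂ)
      (fun z => a * Complex.sin (ψ (z / μ) / 2)) C D := by
  set m : ℂ := (((1 - lam) / (1 + lam) : ℝ) : ℂ) with hm
  have hl1 : (1 - lam : ℂ) ≠ 0 := by
    intro h
    have h' : 1 - lam = 0 := by exact_mod_cast h
    rw [h', mul_zero] at ha2
    norm_num at ha2
  have hl2 : (1 + lam : ℂ) ≠ 0 := by
    intro h
    have h' : 1 + lam = 0 := by exact_mod_cast h
    rw [h', mul_zero] at hκ
    exact hκ0 (pow_eq_zero_iff two_ne_zero |>.1 hκ)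
  have hmm : m = (1 - lam) / (1 + lam) := by rw [hm]; push_cast; rfl
  have hκC : (κ : ℂ) ^ 2 = (1 - lam) * (1 + lam) := by exact_mod_cast congrArg Complex.ofReal hκ
  have haC : (a : ℂ) * κ = 2 * μ := by exact_mod_cast congrArg Complex.ofReal ha
  have ha2C : (a : ℂ) ^ 2 * (1 - lam) = 2 := by exact_mod_cast congrArg Complex.ofReal ha2
  have hμC : (μ : ℂ) ≠ 0 := Complex.ofReal_ne_zero.2 hμ
  set S : ℂ → ℂ := fun z => a * Complex.sin (ψ (z / μ) / 2) with hS
  set D : ℂ → ℂ := fun z => (1 - m * S z ^ 2) ^ (1 / 2 : ℂ) with hD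
  -- Defined so that `C D = cos φ(z/μ)`, which is `S'`.
  set C : ℂ → ℂ := fun z => Complex.cos (φ (z / μ)) / D z with hC
  have hdiv : AnalyticAt ℂ (fun z : ℂ => z / μ) 0 := by fun_prop
  have hdivt : Tendsto (fun z : ℂ => z / μ) (𝓝 0) (𝓝 0) := by
    simpa using hdiv.continuousAt.tendsto
  have hψμ : AnalyticAt ℂ (fun z : ℂ => ψ (z / μ)) 0 :=
    AnalyticAt.comp (f := fun z : ℂ => z / μ) (by simpa using hψ) hdiv
  have hφμ : AnalyticAt ℂ (fun z : ℂ => φ (z / μ)) 0 :=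
    AnalyticAt.comp (f := fun z : ℂ => z / μ) (by simpa using hφ.analyticAt) hdiv
  have hsin_half {u : ℂ → ℂ} (hu : AnalyticAt ℂ u 0) :
      AnalyticAt ℂ (fun z => a * Complex.sin (u z / 2)) 0 := by fun_prop
  have hcos {u : ℂ → ℂ} (hu : AnalyticAt ℂ u 0) : AnalyticAt ℂ (fun z => Complex.cos (u z)) 0 := by
    fun_prop
  have hSa : AnalyticAt ℂ S 0 := hsin_half hψμ
  have hS0 : S 0 = 0 := by simp [hS, hψ0]
  have hX : AnalyticAt ℂ (fun z => 1 - m * S z ^ 2) 0 := by fun_prop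
  have hslit : ∀ᶠ z in 𝓝 (0 : ℂ), 1 - m * S z ^ 2 ∈ Complex.slitPlane :=
    hX.continuousAt.preimage_mem_nhds (Complex.isOpen_slitPlane.mem_nhds (by simp [hS0]))
  have hDa : AnalyticAt ℂ D 0 := hX.cpow analyticAt_const (by simp [hS0])
  have hD0 : D 0 = 1 := by simp [hD, hS0]
  have hCa : AnalyticAt ℂ C 0 := (hcos hφμ).div hDa (by simp [hD0])
  have hC0 : C 0 = 1 := by simp [hC, hD0, hφ.map_zero]
  have hder : ∀ᶠ z in 𝓝 (0 : ℂ), HasDerivAt S (C z * D z) z := by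
    filter_upwards [hdivt.eventually (hφ.eventually_hasDerivAt_shen hψ hψ0 hsin),
      hDa.continuousAt.eventually_ne (by simp [hD0] : D 0 ≠ 0)] with z ⟨h1, h2⟩ h3
    have hd : HasDerivAt (fun z : ℂ => z / μ) (1 / μ) z := (hasDerivAt_id z).div_const _
    have h4 := (((h2.comp z hd).div_const 2).csin).const_mul (a : ℂ)
    refine h4.congr_deriv ?_
    have h5 : C z * D z = Complex.cos (φ (z / μ)) := div_mul_cancel₀ _ h3
    rw [h5]
    simp only [Function.comp_apply]
    field_simp
    linear_combination Complex.cos (φ (z / μ)) * haC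
  have hsq : ∀ᶠ z in 𝓝 (0 : ℂ), C z ^ 2 = 1 - S z ^ 2 := by
    filter_upwards [hdivt.eventually hsin, hslit] with z h1 h2
    have h3 : 1 - m * S z ^ 2 ≠ 0 := Complex.slitPlane_ne_zero h2
    have h4 : D z ^ 2 = 1 - m * S z ^ 2 := Complex.cpow_one_half_sq _
    have h5 := congrArg (· ^ 2) h1
    simp only [mul_pow, Complex.sin_sq (φ _)] at h5
    have h6 : Complex.sin (ψ (z / μ)) =
        2 * Complex.sin (ψ (z / μ) / 2) * Complex.cos (ψ (z / μ) / 2) := by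
      rw [← Complex.sin_two_mul]
      congr 1
      ring
    rw [h6, mul_pow, mul_pow, Complex.cos_sq', hκC] at h5
    have h7 : S z ^ 2 * (1 - lam) = 2 * Complex.sin (ψ (z / μ) / 2) ^ 2 := by
      rw [hS, mul_pow]
      linear_combination Complex.sin (ψ (z / μ) / 2) ^ 2 * ha2C
    have h8 : m * (1 + lam) = 1 - lam := by rw [hmm, div_mul_cancel₀ _ hl2]
    rw [hC, div_pow, h4, div_eq_iff h3]
    refine mul_left_cancel₀ (mul_ne_zero hl1 hl2) ?_
    generalize Complex.sin (ψ (z / μ) / 2) ^ 2 = x at *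
    generalize S z ^ 2 = y at *
    generalize Complex.cos (φ (z / μ)) ^ 2 = w at *
    obtain rfl : x = y * (1 - lam) / 2 := by linear_combination -h7 / 2
    linear_combination h5 + (1 - lam) * (1 - y) * y * h8
  refine ⟨C, D, hS0, hC0, hD0, ?_⟩
  filter_upwards [hder, hsq.eventually_nhds, hslit, hCa.eventually_analyticAt,
    hDa.continuousAt.eventually_ne (by simp [hD0] : D 0 ≠ 0),
    hCa.continuousAt.eventually_ne (by simp [hC0] : C 0 ≠ 0)] with z h1 h2 h3 h4 h5 h6
  refine ⟨h1, ?_, ?_⟩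
  · have h7 := h4.differentiableAt.hasDerivAt
    -- The formula for `C'` comes from differentiating `C² = 1 - S²` and cancelling `C`, which is
    -- nonzero near `0`.
    have h8 := (h7.fun_pow 2).unique (((h1.fun_pow 2).const_sub 1).congr_of_eventuallyEq h2)
    refine h7.congr_deriv (mul_left_cancel₀ h6 ?_)
    push_cast at h8
    linear_combination h8 / 2
  · refine ((((h1.fun_pow 2).const_mul m).const_sub 1).cpow_one_half h3).congr_deriv ?_
    change _ / (2 * D z) = _
    field_simp
    push_cast
    ring

theorem eventually_cos_eq_one_sub_mul_sn_sq {κ lam k : ℝ} {s c d : ℂ → ℂ}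
    (hκ0 : 0 < κ) (hκ1 : κ < 1) (hlam : lam = Real.sqrt (1 - κ ^ 2))
    (hk : k ^ 2 = (1 - lam) / (1 + lam)) (h : IsJacobiFunctions ((k : ℂ) ^ 2) s c d)
    {φ ψ : ℂ → ℂ} (hφ : IsAnalyticLocalInverse (shenIntegral κ) φ) (hψ : AnalyticAt ℂ ψ 0)
    (hψ0 : ψ 0 = 0)
    (hsin : ∀ᶠ z in 𝓝 (0 : ℂ), Complex.sin (ψ z) = (κ : ℂ) * Complex.sin (φ z)) :
    ∀ᶠ z in 𝓝 (0 : ℂ), Complex.cos (ψ z) =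
      1 - (1 - (lam : ℂ)) * s (z * (Real.sqrt ((1 + lam) / 2) : ℂ)) ^ 2 := by
  have hκ2 : κ ^ 2 < 1 := by nlinarith
  have hκ2' : 0 < κ ^ 2 := by positivity
  have hl0 : 0 ≤ lam := hlam ▸ Real.sqrt_nonneg _
  have hl2 : lam ^ 2 = 1 - κ ^ 2 := by rw [hlam, Real.sq_sqrt (by linarith)]
  have hl1 : lam < 1 := by nlinarith
  set μ := Real.sqrt ((1 + lam) / 2) with hμ
  have hμpos : 0 < μ := Real.sqrt_pos.2 (by linarith)
  have hμ2 : μ ^ 2 = (1 + lam) / 2 := Real.sq_sqrt (by linarith)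
  -- The amplitude `a = 2μ/κ` normalises `S'(0) = 1`.
  have ha2 : (2 * μ / κ) ^ 2 * (1 - lam) = 2 := by
    rw [div_pow, mul_pow, hμ2]
    have : κ ^ 2 = (1 - lam) * (1 + lam) := by linarith
    rw [this]
    have h1 : 1 - lam ≠ 0 := by linarith
    have h2 : 1 + lam ≠ 0 := by linarith
    field_simp
  obtain ⟨C, D, ht⟩ := hφ.isJacobiTriple_shen (a := 2 * μ / κ) (μ := μ) hψ hψ0 hsin
    (by linarith) hκ0.ne' (by field_simp) ha2 hμpos.ne'
  rw [← hk, Complex.ofReal_pow] at ht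
  have hμC : (μ : ℂ) ≠ 0 := Complex.ofReal_ne_zero.2 hμpos.ne'
  have hscale : Tendsto (fun z : ℂ => z * μ) (𝓝 0) (𝓝 0) := by
    have : ContinuousAt (fun z : ℂ => z * μ) 0 := by fun_prop
    simpa using this.tendsto
  filter_upwards [hscale.eventually (h.toIsJacobiTriple.eventuallyEq ht).1] with z hz
  rw [hz, mul_div_cancel_right₀ _ hμC]
  have ha2C : (((2 * μ / κ : ℝ) : ℂ)) ^ 2 * (1 - lam) = 2 := by
    exact_mod_cast congrArg Complex.ofReal ha2
  have hcos : Complex.cos (ψ z) = 1 - 2 * Complex.sin (ψ z / 2) ^ 2 := by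
    conv_lhs => rw [show ψ z = 2 * (ψ z / 2) by ring, Complex.cos_two_mul]
    linear_combination 2 * Complex.sin_sq_add_cos_sq (ψ z / 2)
  rw [hcos]
  linear_combination Complex.sin (ψ z / 2) ^ 2 * ha2C

/-- Shen's `dn₂` is the normal form of `1 - (1 - λ) sn²(μ z)`, `μ = √((1 + λ) / 2)`. -/
theorem isShenDn2_iff {κ lam k : ℝ} {s c d : ℂ → ℂ}
    (hκ0 : 0 < κ) (hκ1 : κ < 1) (hlam : lam = Real.sqrt (1 - κ ^ 2)) (hk0 : 0 < k)
    (hk : k ^ 2 = (1 - lam) / (1 + lam)) (h : IsJacobiFunctions ((k : ℂ) ^ 2) s c d)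
    (f : ℂ → ℂ) :
    IsShenDn2 κ f ↔ f = toMeromorphicNFOn
      (fun z => 1 - (1 - (lam : ℂ)) * s (z * (Real.sqrt ((1 + lam) / 2) : ℂ)) ^ 2) Set.univ := by
  have hl0 : 0 < lam := hlam ▸ Real.sqrt_pos.2 (by nlinarith)
  have hk1 : k < 1 := by
    have : k ^ 2 < 1 := by rw [hk, div_lt_one (by linarith)]; linarith
    nlinarith
  have hμ : 0 < Real.sqrt ((1 + lam) / 2) := Real.sqrt_pos.2 (by linarith)
  have hcos := @eventually_cos_eq_one_sub_mul_sn_sq κ lam k s c d hκ0 hκ1 hlam hk h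
  set μ : ℝ := Real.sqrt ((1 + lam) / 2)
  have hμC : (μ : ℂ) ≠ 0 := Complex.ofReal_ne_zero.2 hμ.ne'
  set G : ℂ → ℂ := fun z => 1 - (1 - (lam : ℂ)) * s (z * μ) ^ 2 with hG
  have hGmero : MeromorphicOn G Set.univ := fun z _ => by
    have h1 : MeromorphicAt (fun z => s (z * μ)) z :=
      MeromorphicAt.comp_analyticAt (g := fun z : ℂ => z * μ)
        (h.sn_mero (Set.mem_univ _)).meromorphicAt (by fun_prop)
    exact (MeromorphicAt.const _ z).sub ((MeromorphicAt.const _ z).mul (h1.pow 2))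
  -- At a pole of `s(μz)` the normal form `s` has value `0`, so `G` has value `1` there; normalising
  -- resets it to `0`.
  have hnf : MeromorphicNFOn (toMeromorphicNFOn G Set.univ) Set.univ :=
    meromorphicNFOn_toMeromorphicNFOn _ _
  have hGeq : toMeromorphicNFOn G Set.univ =ᶠ[𝓝[≠] 0] G :=
    hGmero.toMeromorphicNFOn_eq_self_on_nhdsNE (Set.mem_univ 0)
  constructor
  · rintro ⟨⟨hf, -⟩, φ, ψ, hφ, hψ, hψ0, hsin, hfψ⟩
    exact MeromorphicNFOn.eq_of_eventuallyEq hf hnf (x := 0)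
      (((EventuallyEq.trans hfψ (hcos hφ hψ hψ0 hsin)).filter_mono nhdsWithin_le_nhds).trans
        hGeq.symm)
  · rintro rfl
    refine ⟨⟨hnf, ?_⟩, ?_⟩
    · obtain ⟨L, L', hL, hL', hper, hper'⟩ := h.exists_periods hk0 hk1
      have hGper {ω : ℂ} (hω : ∀ z, s (z + ω) ^ 2 = s z ^ 2) : G.Periodic (ω / μ) := by
        intro z
        simp only [hG, add_mul, div_mul_cancel₀ _ hμC, hω]
      refine ⟨L / μ, Complex.I * L' / μ, ?_,
        hnf.periodic_of_eventuallyEq hGmero hGeq (hGper hper),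
        hnf.periodic_of_eventuallyEq hGmero hGeq (hGper hper')⟩
      rw [LinearIndependent.pair_iff]
      -- After removing `μ` one period is real and the other purely imaginary, so real and imaginary
      -- parts separate the coefficients.
      intro a b hab
      simp only [Complex.real_smul] at hab
      have h1 : (a * L : ℂ) + b * L' * Complex.I = 0 := by
        field_simp at hab
        linear_combination hab
      have hre := congrArg Complex.re h1
      have him := congrArg Complex.im h1
      simp at hre him
      exact ⟨hre.resolve_right hL.ne', him.resolve_right hL'.ne'⟩
    · obtain ⟨φ, hφ⟩ := exists_isAnalyticLocalInverse_shenIntegral κ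
      obtain ⟨ψ, hψ, hψ0, hsin⟩ := exists_sin_eq_mul_sin hφ.analyticAt hφ.map_zero (κ : ℂ)
      have h0 := hcos hφ hψ hψ0 hsin
      exact ⟨φ, ψ, hφ, hψ, hψ0, hsin,
        ((hnf (Set.mem_univ 0)).eventuallyEq_nhdsNE_iff_eventuallyEq_nhds
          (by fun_prop : AnalyticAt ℂ (fun z => Complex.cos (ψ z)) 0).meromorphicNFAt).1
          (hGeq.trans (EventuallyEq.symm (h0.filter_mono nhdsWithin_le_nhds)))⟩

/-! ### Comparison of poles and the main theorem. -/

theorem MeromorphicNFAt.not_hasPoleAt_iff {f : ℂ → ℂ} {z : ℂ} (hf : MeromorphicNFAt f z) :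
    ¬ HasPoleAt f z ↔ AnalyticAt ℂ f z := by
  rw [← hf.meromorphicOrderAt_nonneg_iff_analyticAt, HasPoleAt, not_and, not_lt]
  exact ⟨fun h => h hf.meromorphicAt, fun h _ => h⟩

/-- If the square of a function in normal form is analytic, so is the function. -/
theorem MeromorphicNFAt.analyticAt_of_sq {f g : ℂ → ℂ} {z : ℂ} (hf : MeromorphicNFAt f z)
    (hg : AnalyticAt ℂ g z) (h : (fun w => f w ^ 2) =ᶠ[𝓝[≠] z] g) : AnalyticAt ℂ f z := by
  rw [← hf.meromorphicOrderAt_nonneg_iff_analyticAt]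
  have h1 : meromorphicOrderAt (f ^ 2) z = meromorphicOrderAt g z := meromorphicOrderAt_congr h
  have h2 := hg.meromorphicOrderAt_nonneg
  rw [← h1, pow_two, meromorphicOrderAt_mul hf.meromorphicAt hf.meromorphicAt] at h2
  by_contra! hlt
  generalize meromorphicOrderAt f z = o at h2 hlt
  lift o to ℤ using hlt.ne_top
  norm_cast at h2 hlt
  omega

theorem mainTheorem7 (κ lam k : ℝ) (hκ0 : 0 < κ) (hκ1 : κ < 1)
    (hlam : lam = Real.sqrt (1 - κ ^ 2))
    (hk0 : 0 < k) (hk : k ^ 2 = (1 - lam) / (1 + lam)) :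
    (∃! d : ℂ → ℂ, IsShenDn2 κ d) ∧
    (∃! s : ℂ → ℂ, IsJacobiSn k s) ∧
    IsShenDn2 κ (shenDn2 κ) ∧
    IsJacobiSn k (jacobiSn k) ∧
    ∀ z : ℂ,
      (HasPoleAt (shenDn2 κ) z ↔
        HasPoleAt (jacobiSn k) (z * (Real.sqrt ((1 + lam) / 2) : ℂ))) ∧
      (¬ HasPoleAt (shenDn2 κ) z →
        shenDn2 κ z =
          1 - (1 - (lam : ℂ)) * jacobiSn k (z * (Real.sqrt ((1 + lam) / 2) : ℂ)) ^ 2) := by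
  obtain ⟨s, c, d, h⟩ := exists_isJacobiFunctions k
  have hsn := isJacobiSn_iff h
  have hdn := isShenDn2_iff hκ0 hκ1 hlam hk0 hk h
  have hsn1 : ∃! s : ℂ → ℂ, IsJacobiSn k s := ⟨s, (hsn s).2 rfl, fun f hf => (hsn f).1 hf⟩
  have hdn1 : ∃! d : ℂ → ℂ, IsShenDn2 κ d := ⟨_, (hdn _).2 rfl, fun f hf => (hdn f).1 hf⟩
  have hS : IsJacobiSn k (jacobiSn k) := Classical.epsilon_spec hsn1.exists
  have hD : IsShenDn2 κ (shenDn2 κ) := Classical.epsilon_spec hdn1.exists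
  refine ⟨hdn1, hsn1, hD, hS, fun z => ?_⟩
  have hDnf : MeromorphicNFAt (shenDn2 κ) z := hD.1.1 (Set.mem_univ z)
  rw [(hsn _).1 hS]
  have hl0 : 0 < lam := hlam ▸ Real.sqrt_pos.2 (by nlinarith)
  have hlam1 : (1 - lam : ℂ) ≠ 0 := by
    have : lam ^ 2 = 1 - κ ^ 2 := by rw [hlam, Real.sq_sqrt (by nlinarith)]
    have : 1 - lam ≠ 0 := fun h => by nlinarith
    exact_mod_cast this
  have hμ : 0 < Real.sqrt ((1 + lam) / 2) := Real.sqrt_pos.2 (by linarith)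
  have hDeq := (hdn _).1 hD
  set μ : ℝ := Real.sqrt ((1 + lam) / 2)
  have hμC : (μ : ℂ) ≠ 0 := Complex.ofReal_ne_zero.2 hμ.ne'
  have hscale : ∀ w : ℂ, AnalyticAt ℂ (fun w : ℂ => w * μ) w := fun w => by fun_prop
  have hderiv : deriv (fun w : ℂ => w * μ) z ≠ 0 := by simpa using hμC
  have hsnf : MeromorphicNFAt s (z * μ) := h.sn_mero (Set.mem_univ _)
  have hscale_nf : MeromorphicNFAt (fun w => s (w * μ)) z :=
    MeromorphicNFAt.comp_analyticAt (g := fun w : ℂ => w * μ) hsnf (hscale z)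
  have hmero : MeromorphicOn (fun w => 1 - (1 - (lam : ℂ)) * s (w * μ) ^ 2) Set.univ :=
    fun w _ => (MeromorphicAt.const _ w).sub ((MeromorphicAt.const _ w).mul
      ((MeromorphicAt.comp_analyticAt (g := fun z : ℂ => z * μ)
        (h.sn_mero (Set.mem_univ _)).meromorphicAt (hscale w)).pow 2))
  have hev : shenDn2 κ =ᶠ[𝓝[≠] z] fun w => 1 - (1 - (lam : ℂ)) * s (w * μ) ^ 2 := by
    rw [hDeq]
    exact hmero.toMeromorphicNFOn_eq_self_on_nhdsNE (Set.mem_univ z)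
  -- Solving the identity for `sn²` is possible because `1 - λ ≠ 0`; analyticity of the square then
  -- passes to `sn`.
  have hforward (hd : AnalyticAt ℂ (shenDn2 κ) z) : AnalyticAt ℂ (fun w => s (w * μ)) z := by
    refine hscale_nf.analyticAt_of_sq (g := fun w => (1 - shenDn2 κ w) / (1 - lam))
      (by fun_prop (disch := assumption)) ?_
    filter_upwards [hev] with w hw
    rw [hw]
    field_simp
    ring
  have hback (hs : AnalyticAt ℂ (fun w => s (w * μ)) z) :
      shenDn2 κ =ᶠ[𝓝 z] fun w => 1 - (1 - (lam : ℂ)) * s (w * μ) ^ 2 :=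
    (hDnf.eventuallyEq_nhdsNE_iff_eventuallyEq_nhds
      (analyticAt_const.sub (analyticAt_const.mul (hs.pow 2))).meromorphicNFAt).1 hev
  have hcomp : AnalyticAt ℂ (fun w => s (w * μ)) z ↔ AnalyticAt ℂ s (z * μ) :=
    analyticAt_comp_iff_of_deriv_ne_zero (f := fun w : ℂ => w * μ) (hscale z) hderiv
  refine ⟨not_iff_not.1 ?_, fun hd => ?_⟩
  · rw [hDnf.not_hasPoleAt_iff, hsnf.not_hasPoleAt_iff, ← hcomp]
    exact ⟨hforward, fun hs =>
      (analyticAt_const.sub (analyticAt_const.mul (hs.pow 2))).congr (hback hs).symm⟩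
  · exact (hback (hforward (hDnf.not_hasPoleAt_iff.1 hd))).eq_of_nhds
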